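/- Notation. $\|\cdot\|$ is the Euclidean norm, $B^d(R)=\{x\in\mathbb R^d:\|x\|\le R\}$, $\mathrm{ReLU}(x)=\max(x,0)$. For a set $S$ of functions $\mathbb R\to\mathbb R$, an $\ell$-layer neural net ($\ell\ge2$) with activations in $S$ is a map obtained as follows: a two-layer net is $x\mapsto\big(\sum_{i=1}^m\alpha_{ri}\,\sigma_i(w_i^{T}x+\beta_i)\big)_r$ with $m\ge1$ neurons, $\sigma_i\in S$ and real parameters; an $(\ell+1)$-layer net is $x\mapsto\big(\sum_{i=1}^m\alpha_{ri}\,\sigma_i(w_i^{T}h(x)+\beta_i)\big)_r$, where $h=(h_1,\dots,h_k)$ is a vector-valued $\ell$-layer net. Its size is the total number of neurons. For $f:\mathbb R^d\to\mathbb R$ and $t\ge 0$ let $$U_tf(y)=\mathbb E_{Z\sim\mathcal N(0,I)}\big[f\big(e^{-t}y+(1-e^{-2t})^{1/2}Z\big)\big]$$ be the Ornstein–Uhlenbeck semigroup. Assumption on the activation. $\sigma:\mathbb R\to\mathbb R$ is differentiable, and there is $c_\sigma>0$ such that for all $L\ge0$, $R>0$, $\delta>0$ and every $L$-Lipschitz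 $h:\mathbb R\to\mathbb R$ which is constant outside $[-R,R]$ there are $m\le c_\sigma RL/\delta$ and real numbers $a,\alpha_i,\beta_i,\gamma_i$ ($1\le i\le m$) with $\sup_{x\in\mathbb R}\big|a+\sum_{i=1}^m\alpha_i\sigma(\beta_ix+\gamma_i)-h(x)\big|\le\delta$. Theorem. Fix $\sigma$ satisfying this assumption, and a polynomial $p$ in four variables. There is a polynomial $q$ in six variables, depending only on $\sigma$ and $p$, such that the following holds. Let $d$ be a natural number, let $\pi$ be a probability measure on $\mathbb R^d$ with density $f=\mathrm d\pi/\mathrm d\mathcal N(0,I)$ with respect to the standard Gaussian measure, and suppose that 1. $f$ is differentiable, $f$ and $\nabla f$ are $L$-Lipschitz, and $f\ge c$ everywhere, where $c\in(0,1]$; 2. for all $R>0$ and $\varepsilon>0$ there is a neural net $\hat f:\mathbb R^d\to\mathbb R$ with activation $\sigma$, whose number of layers and size are both less than $p(1/\varepsilon,d,L,R)$, such that $|f(x)-\hat f(x)|\le\varepsilon$ and $\|\nabla f(x)-\nabla\hat f(x)\|\le\varepsilon$ for all $x\in B^d(R)$. Then for all $0<\varepsilon<4L/c$ and $R>0$ there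 is a neural net $\hat v:\mathbb R^d\times[0,1]\to\mathbb R^d$ of size at most $q(1/\varepsilon,d,L,R,c,1/c)$, the activation function of each neuron being an element of $\{\sigma,\sigma',\mathrm{ReLU}\}$, such that $\log U_tf$ is differentiable at every $x\in B^d(R)$ for every $t\in[0,1]$, $$\sup_{x\in B^d(R)}\ \sup_{t\in[0,1]}\big\|\hat v(x,t)-\nabla\log U_tf(x)\big\|\le\varepsilon,$$ and $$\max_{1\le i\le d}\ \sup_{x\in\mathbb R^d}\ \sup_{t\in[0,1]}\big|\hat v_i(x,t)\big|\le\frac{2L}{c}.$$ -/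

import Mathlib

open MeasureTheory ProbabilityTheory
open scoped NNReal Matrix

noncomputable section

/-- The rectified linear unit. -/
def relu (x : ℝ) : ℝ := max x 0

/-- `IsNeuralNet S n ℓ s k F`: the map `F : ℝⁿ → ℝᵏ` is computed by an `ℓ`-layer feedforward neural
net with `s` neurons, the activation function of each neuron being an element of `S`.

A two-layer net maps `x` to the vector whose `r`-th coordinate is
`∑ i, A r i * act i (⟨W i, x⟩ + b i)`, with `m ≥ 1` neurons; an `(ℓ+1)`-layer net applies a map
of this form to the vector `h x = (h₁ x, …, h_j x)` of the outputs of an `ℓ`-layer net. The size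
is the total number of neurons. -/
inductive IsNeuralNet (S : Set (ℝ → ℝ)) (n : ℕ) :
    (ℓ s k : ℕ) → ((Fin n → ℝ) → (Fin k → ℝ)) → Prop
  | two_layers {m k : ℕ} (hm : 0 < m) (act : Fin m → ℝ → ℝ) (hact : ∀ i, act i ∈ S)
      (W : Matrix (Fin m) (Fin n) ℝ) (b : Fin m → ℝ) (A : Matrix (Fin k) (Fin m) ℝ) :
      IsNeuralNet S n 2 m k (fun x => A *ᵥ fun i => act i ((W *ᵥ x) i + b i))
  | add_layer {ℓ s j m k : ℕ} {h : (Fin n → ℝ) → (Fin j → ℝ)} (hh : IsNeuralNet S n ℓ s j h)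
      (hm : 0 < m) (act : Fin m → ℝ → ℝ) (hact : ∀ i, act i ∈ S)
      (W : Matrix (Fin m) (Fin j) ℝ) (b : Fin m → ℝ) (A : Matrix (Fin k) (Fin m) ℝ) :
      IsNeuralNet S n (ℓ + 1) (s + m) k (fun x => A *ᵥ fun i => act i ((W *ᵥ h x) i + b i))

/-- The assumption on the activation function: `σ` is differentiable, and Lipschitz functions of one
variable that are constant outside `[-R, R]` are uniformly approximated to accuracy `δ` by
superpositions of at most `cσ * R * L / δ` translated and dilated copies of `σ`. -/
def ActivationAssumption (σ : ℝ → ℝ) : Prop :=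
  Differentiable ℝ σ ∧
    ∃ cσ : ℝ, 0 < cσ ∧
      ∀ (L : ℝ≥0) (R δ : ℝ) (h : ℝ → ℝ), 0 < R → 0 < δ → LipschitzWith L h →
        (∃ h₀ : ℝ, ∀ x ∉ Set.Icc (-R) R, h x = h₀) →
        ∃ (m : ℕ) (a : ℝ) (α β γ : Fin m → ℝ), (m : ℝ) ≤ cσ * (R * L / δ) ∧
          ∀ x : ℝ, |a + ∑ i, α i * σ (β i * x + γ i) - h x| ≤ δ

/-- The assumption on `f`: on each ball `B^d(R)`, both `f` and its gradient are uniformly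
approximated to accuracy `ε` by a `σ`-net whose depth and size are less than `p (1/ε, d, L, R)`. -/
def NetApproximable (σ : ℝ → ℝ) (p : MvPolynomial (Fin 4) ℝ) {d : ℕ} (L : ℝ≥0)
    (f : EuclideanSpace ℝ (Fin d) → ℝ) : Prop :=
  ∀ R ε : ℝ, 0 < R → 0 < ε →
    ∃ (ℓ s : ℕ) (F : (Fin d → ℝ) → (Fin 1 → ℝ)), IsNeuralNet {σ} d ℓ s 1 F ∧
      (ℓ : ℝ) < p.eval ![1 / ε, (d : ℝ), (L : ℝ), R] ∧
      (s : ℝ) < p.eval ![1 / ε, (d : ℝ), (L : ℝ), R] ∧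
      ∀ x ∈ Metric.closedBall (0 : EuclideanSpace ℝ (Fin d)) R,
        |f x - F x.ofLp 0| ≤ ε ∧
        ‖gradient f x - gradient (fun y : EuclideanSpace ℝ (Fin d) => F y.ofLp 0) x‖ ≤ ε

/-- The Ornstein–Uhlenbeck semigroup
`U_t f(y) = 𝔼_{Z ∼ N(0, I)} [f (e^{-t} y + (1 - e^{-2t})^{1/2} Z)]`. -/
def ouSemigroup {d : ℕ} (t : ℝ) (f : EuclideanSpace ℝ (Fin d) → ℝ)
    (y : EuclideanSpace ℝ (Fin d)) : ℝ :=
  ∫ z, f (Real.exp (-t) • y + Real.sqrt (1 - Real.exp (-2 * t)) • z)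
    ∂(stdGaussian (EuclideanSpace ℝ (Fin d)))

/-- For Lipschitz `f` the integrals defining `U_t f` converge. -/
theorem integrable_ouSemigroup {d : ℕ} {L : ℝ≥0} {f : EuclideanSpace ℝ (Fin d) → ℝ}
    (hf : LipschitzWith L f) (t : ℝ) (y : EuclideanSpace ℝ (Fin d)) :
    Integrable (fun z => f (Real.exp (-t) • y + Real.sqrt (1 - Real.exp (-2 * t)) • z))
      (stdGaussian (EuclideanSpace ℝ (Fin d))) := by
  set T : EuclideanSpace ℝ (Fin d) → EuclideanSpace ℝ (Fin d) :=
    fun z => Real.exp (-t) • y + Real.sqrt (1 - Real.exp (-2 * t)) • z with hT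
  have hid : Integrable (fun z : EuclideanSpace ℝ (Fin d) => z)
      (stdGaussian (EuclideanSpace ℝ (Fin d))) := IsGaussian.integrable_id
  have hTi : Integrable T (stdGaussian (EuclideanSpace ℝ (Fin d))) :=
    (integrable_const _).add (hid.fun_smul _)
  have hb : Integrable (fun z => |f 0| + L * ‖T z‖)
      (stdGaussian (EuclideanSpace ℝ (Fin d))) :=
    (integrable_const _).add (hTi.norm.const_mul _)
  have hc : Continuous T := by fun_prop
  refine hb.mono' (hf.continuous.comp hc).aestronglyMeasurable (Filter.Eventually.of_forall ?_)
  intro z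
  have h1 := hf.dist_le_mul (T z) 0
  rw [dist_zero_right, Real.dist_eq] at h1
  have h2 := abs_add_le (f (T z) - f 0) (f 0)
  rw [sub_add_cancel] at h2
  rw [Real.norm_eq_abs]
  linarith

/-- The input vector `(x, t) ∈ ℝ^{d+1}` of a net on `ℝ^d × [0, 1]`. -/
def withTime {d : ℕ} (x : EuclideanSpace ℝ (Fin d)) (t : ℝ) : Fin (d + 1) → ℝ :=
  Fin.snoc (α := fun _ => ℝ) x.ofLp t

end

/-! Since `f ≥ c`, also `U_t f ≥ c`, so `log U_t f` is as regular as `U_t f`: each coordinate of its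
gradient is bounded by `L/c` and is Lipschitz with constant `L/c + L²/c²`. A forward difference
quotient with step `h` therefore differs from a partial derivative by at most `(L/c + L²/c²) h`
(`abs_difference_quotient_sub_gradient_le`), and it suffices to approximate the values of `log U_t
f` to accuracy of order `ε h / d`.

The Gaussian expectation defining `U_t f` is replaced by an average over fixed sample points.
Hoeffding's inequality and a union bound over a grid of pairs `(a, s)` show that one sample of
polynomial size serves all averages of `f (a + s • Z)` with `‖a‖ ≤ A`, `|s| ≤ 1`, hence all `x` and
`t` at once (`LipschitzWith.exists_uniform_sample`). The grid is exponentially large in `d`, but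
only its logarithm enters.

The rest is computed by a net. The one-variable functions `e^{-t}`, `√(1 - e^{-2t})`, `y²` and `log`
are approximated by superpositions of `σ`; the product `e^{-t} x_k` comes from squares by
polarization; copies of the given net evaluate `f` at the sample arguments; linear maps between
layers are free. Clipping the outputs to `[-2L/c, 2L/c]` with ReLUs gives the global bound and
cannot increase the error, since the true values lie in `[-L/c, L/c]`. `netOutput_approxScore`
counts neurons, `norm_approxScore_sub_gradient_le` bounds the error, and `exists_net_score` chooses
the parameters. -/

/-- The components of `F` are linear combinations of the outputs of a neural net of size `s`. -/
def NetOutput (S : Set (ℝ → ℝ)) (n s : ℕ) {κ : Type*} (F : (Fin n → ℝ) → κ → ℝ) : Prop :=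
  ∃ (ℓ k : ℕ) (G : (Fin n → ℝ) → Fin k → ℝ), IsNeuralNet S n ℓ s k G ∧
    ∃ B : (Fin k → ℝ) →ₗ[ℝ] (κ → ℝ), ∀ x, F x = B (G x)

/-! ### Calculus of nets: linear maps, layers, parallel copies, superpositions. -/

section Nets

variable {S : Set (ℝ → ℝ)} {n s : ℕ} {κ μ ν : Type*}

/-- Composing a neural net with a linear map does not change its size. -/
theorem IsNeuralNet.linear_comp {ℓ k j : ℕ} {G : (Fin n → ℝ) → Fin k → ℝ}
    (hG : IsNeuralNet S n ℓ s k G) (B : (Fin k → ℝ) →ₗ[ℝ] (Fin j → ℝ)) :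
    IsNeuralNet S n ℓ s j (fun x => B (G x)) := by
  -- A net ends with a matrix of output weights, which absorbs `B`.
  have key : ∀ {m : ℕ} (A : Matrix (Fin k) (Fin m) ℝ) (u : Fin m → ℝ),
      B (A *ᵥ u) = (LinearMap.toMatrix' B * A) *ᵥ u := by
    intro m A u
    rw [← Matrix.mulVec_mulVec, LinearMap.toMatrix'_mulVec]
  cases hG with
  | two_layers hm act hact W b A =>
    simp_rw [key]
    exact .two_layers hm act hact W b _
  | add_layer hh hm act hact W b A =>
    simp_rw [key]
    exact .add_layer hh hm act hact W b _

theorem NetOutput.isNeuralNet {k : ℕ} {F : (Fin n → ℝ) → Fin k → ℝ} (hF : NetOutput S n s F) :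
    ∃ ℓ, IsNeuralNet S n ℓ s k F := by
  obtain ⟨ℓ, j, G, hG, B, hB⟩ := hF
  refine ⟨ℓ, ?_⟩
  rw [show F = fun x => B (G x) from funext hB]
  exact hG.linear_comp B

/-- Linear post-processing is free. With arbitrary index types, layers can be indexed by products
and sums rather than by `Fin`. -/
theorem NetOutput.linear {F : (Fin n → ℝ) → κ → ℝ} (hF : NetOutput S n s F)
    {Ψ : (κ → ℝ) → ν → ℝ} (hΨ : IsLinearMap ℝ Ψ) : NetOutput S n s (fun x => Ψ (F x)) := by
  obtain ⟨ℓ, j, G, hG, B, hB⟩ := hF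
  exact ⟨ℓ, j, G, hG, (hΨ.mk' Ψ).comp B, fun x => by simp [hB]⟩

theorem NetOutput.layer [Fintype μ] [Nonempty μ] {F : (Fin n → ℝ) → κ → ℝ}
    (hF : NetOutput S n s F) {Φ : (κ → ℝ) → μ → ℝ} (hΦ : IsLinearMap ℝ Φ)
    (act : μ → ℝ → ℝ) (hact : ∀ i, act i ∈ S) (b : μ → ℝ) :
    NetOutput S n (s + Fintype.card μ) (fun x i => act i (Φ (F x) i + b i)) := by
  obtain ⟨ℓ, k, G, hG, B, hB⟩ := hF
  let e := Fintype.equivFin μ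
  refine ⟨ℓ + 1, Fintype.card μ, _, .add_layer hG Fintype.card_pos (fun i => act (e.symm i))
    (fun i => hact _)
    (LinearMap.toMatrix' ((LinearMap.funLeft ℝ ℝ e.symm).comp ((hΦ.mk' Φ).comp B)))
    (fun i => b (e.symm i)) 1, LinearMap.funLeft ℝ ℝ e, fun x => ?_⟩
  funext i
  simp [LinearMap.toMatrix'_mulVec, LinearMap.funLeft_apply, hB]

theorem NetOutput.first_layer [Fintype μ] [Nonempty μ] {Φ : (Fin n → ℝ) → μ → ℝ}
    (hΦ : IsLinearMap ℝ Φ) (act : μ → ℝ → ℝ) (hact : ∀ i, act i ∈ S) (b : μ → ℝ) :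
    NetOutput S n (Fintype.card μ) (fun x i => act i (Φ x i + b i)) := by
  let e := Fintype.equivFin μ
  refine ⟨2, Fintype.card μ, _, .two_layers Fintype.card_pos (fun i => act (e.symm i))
    (fun i => hact _)
    (LinearMap.toMatrix' ((LinearMap.funLeft ℝ ℝ e.symm).comp (hΦ.mk' Φ)))
    (fun i => b (e.symm i)) 1, LinearMap.funLeft ℝ ℝ e, fun x => ?_⟩
  funext i
  simp [LinearMap.toMatrix'_mulVec, LinearMap.funLeft_apply]

/-- A net of size `s` evaluated at several linear images of the output of another net. -/
theorem NetOutput.copies {S' : Set (ℝ → ℝ)} (hS : S' ⊆ S) {Q : Type*} [Fintype Q] [Nonempty Q]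
    {d ℓ r k : ℕ} {G : (Fin d → ℝ) → Fin k → ℝ} (hG : IsNeuralNet S' d ℓ r k G)
    {H : (Fin n → ℝ) → κ → ℝ} (hH : NetOutput S n s H)
    {Φ : (κ → ℝ) → Q → Fin d → ℝ} (hΦ : IsLinearMap ℝ Φ) :
    NetOutput S n (s + Fintype.card Q * r) (fun x (q : Q × Fin k) => G (Φ (H x) q.1) q.2) := by
  -- Each layer of `G` is replaced by one layer with neurons indexed by `Q × Fin m`. The net for `H`
  -- is shared by all copies, so its size is counted once.
  induction hG with
  | two_layers hm act hact W b A =>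
    rename_i m k
    have : Nonempty (Fin m) := ⟨⟨0, hm⟩⟩
    have h1 := hH.layer (μ := Q × Fin m) (Φ := fun u q => (W *ᵥ Φ u q.1) q.2)
      ⟨fun u v => by funext q; simp [hΦ.map_add, Matrix.mulVec_add],
        fun c u => by funext q; simp [hΦ.map_smul, Matrix.mulVec_smul]⟩
      (fun q => act q.2) (fun q => hS (hact _)) (fun q => b q.2)
    have h2 := h1.linear (Ψ := fun u (q : Q × Fin k) => (A *ᵥ fun i => u (q.1, i)) q.2)
      ⟨fun u v => by
          funext q; simp only [Pi.add_apply]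
          exact congrFun (Matrix.mulVec_add A (fun i => u (q.1, i)) (fun i => v (q.1, i))) q.2,
        fun c u => by
          funext q; simp only [Pi.smul_apply]
          exact congrFun (Matrix.mulVec_smul A c (fun i => u (q.1, i))) q.2⟩
    simpa [Fintype.card_prod] using h2
  | add_layer hh hm act hact W b A ih =>
    rename_i ℓ r j m k h
    have : Nonempty (Fin m) := ⟨⟨0, hm⟩⟩
    have h1 := ih.layer (μ := Q × Fin m) (Φ := fun u q => (W *ᵥ fun i => u (q.1, i)) q.2)
      ⟨fun u v => by
          funext q; simp only [Pi.add_apply]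
          exact congrFun (Matrix.mulVec_add W (fun i => u (q.1, i)) (fun i => v (q.1, i))) q.2,
        fun c u => by
          funext q; simp only [Pi.smul_apply]
          exact congrFun (Matrix.mulVec_smul W c (fun i => u (q.1, i))) q.2⟩
      (fun q => act q.2) (fun q => hS (hact _)) (fun q => b q.2)
    have h2 := h1.linear (Ψ := fun u (q : Q × Fin k) => (A *ᵥ fun i => u (q.1, i)) q.2)
      ⟨fun u v => by
          funext q; simp only [Pi.add_apply]
          exact congrFun (Matrix.mulVec_add A (fun i => u (q.1, i)) (fun i => v (q.1, i))) q.2,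
        fun c u => by
          funext q; simp only [Pi.smul_apply]
          exact congrFun (Matrix.mulVec_smul A c (fun i => u (q.1, i))) q.2⟩
    simpa [Fintype.card_prod, mul_add, add_assoc] using h2

/-- `g` is a linear combination of `m` dilated and translated activation functions. -/
def IsSuperposition (S : Set (ℝ → ℝ)) (m : ℕ) (g : ℝ → ℝ) : Prop :=
  ∃ (act : Fin m → ℝ → ℝ) (α β γ : Fin m → ℝ), (∀ i, act i ∈ S) ∧
    ∀ y, g y = ∑ i, α i * act i (β i * y + γ i)

theorem IsSuperposition.add {m m' : ℕ} {g g' : ℝ → ℝ} (h : IsSuperposition S m g)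
    (h' : IsSuperposition S m' g') : IsSuperposition S (m + m') (fun y => g y + g' y) := by
  obtain ⟨act, α, β, γ, ha, hg⟩ := h
  obtain ⟨act', α', β', γ', ha', hg'⟩ := h'
  refine ⟨Fin.append act act', Fin.append α α', Fin.append β β', Fin.append γ γ', ?_, ?_⟩
  · intro i
    refine Fin.addCases (fun i => ?_) (fun i => ?_) i <;> simp [ha, ha']
  · intro y
    simp [Fin.sum_univ_add, hg, hg']

theorem isSuperposition_relu (hS : relu ∈ S) (α β γ : ℝ) :
    IsSuperposition S 1 (fun y => α * relu (β * y + γ)) :=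
  ⟨fun _ => relu, fun _ => α, fun _ => β, fun _ => γ, fun _ => hS, fun y => by simp⟩

theorem isSuperposition_zero (hS : relu ∈ S) (m : ℕ) : IsSuperposition S m (fun _ => 0) :=
  ⟨fun _ => relu, 0, 0, 0, fun _ => hS, fun y => by simp⟩

theorem IsSuperposition.mono (hS : relu ∈ S) {m m' : ℕ} {g : ℝ → ℝ} (h : IsSuperposition S m g)
    (hm : m ≤ m') : IsSuperposition S m' g := by
  obtain ⟨j, rfl⟩ := Nat.exists_eq_add_of_le hm
  simpa using h.add (isSuperposition_zero hS j)

theorem isSuperposition_const (hS : relu ∈ S) (a : ℝ) : IsSuperposition S 1 (fun _ => a) := by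
  simpa [relu] using isSuperposition_relu hS a 0 1

theorem isSuperposition_id (hS : relu ∈ S) : IsSuperposition S 2 (fun y => y) := by
  convert (isSuperposition_relu hS 1 1 0).add (isSuperposition_relu hS (-1) (-1) 0) using 2 with y
  rcases le_total y 0 with h | h <;> simp [relu, h]

/-- Truncation to `[-M, M]` is computed by three rectified linear units. -/
theorem isSuperposition_clip (hS : relu ∈ S) {M : ℝ} (hM : 0 ≤ M) :
    IsSuperposition S 3 (fun y => max (-M) (min y M)) := by
  -- The truncation equals `relu (y + M) - relu (y - M) - M`; the third neuron supplies the
  -- constant.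
  convert ((isSuperposition_relu hS 1 1 M).add (isSuperposition_relu hS (-1) 1 (-M))).add
    (isSuperposition_const hS (-M)) using 2 with y
  simp only [relu, max_def, min_def]
  split_ifs <;> linarith

theorem NetOutput.superposition [Fintype ν] [Nonempty ν] {m : ℕ} (hm : 0 < m)
    {F : (Fin n → ℝ) → κ → ℝ} (hF : NetOutput S n s F) {Φ : (κ → ℝ) → ν → ℝ}
    (hΦ : IsLinearMap ℝ Φ) {g : ν → ℝ → ℝ} (hg : ∀ r, IsSuperposition S m (g r)) :
    NetOutput S n (s + Fintype.card ν * m) (fun x r => g r (Φ (F x) r)) := by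
  choose act α β γ hact hsum using hg
  have : Nonempty (Fin m) := ⟨⟨0, hm⟩⟩
  have h1 := hF.layer (μ := ν × Fin m) (Φ := fun u q => β q.1 q.2 * Φ u q.1)
    ⟨fun u v => by funext q; simp [hΦ.map_add, mul_add],
      fun c u => by funext q; simp [hΦ.map_smul]; ring⟩
    (fun q => act q.1 q.2) (fun q => hact _ _) (fun q => γ q.1 q.2)
  have h2 := h1.linear (Ψ := fun u r => ∑ i, α r i * u (r, i))
    ⟨fun u v => by funext r; simp [mul_add, Finset.sum_add_distrib],
      fun c u => by
        funext r
        simp only [Pi.smul_apply, smul_eq_mul, Finset.mul_sum]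
        exact Finset.sum_congr rfl fun i _ => by ring⟩
  simpa [hsum] using h2

/-- The identity is a net with two rectified linear units per input. -/
theorem netOutput_id (hS : relu ∈ S) [NeZero n] :
    NetOutput S n (n * 2) (fun x => x) := by
  have h1 := NetOutput.first_layer (S := S) (n := n) (μ := Fin n × Bool)
    (Φ := fun x q => if q.2 then x q.1 else - x q.1)
    ⟨fun u v => by funext q; simp only [Pi.add_apply]; split_ifs <;> ring,
      fun c u => by funext q; simp only [Pi.smul_apply, smul_eq_mul]; split_ifs <;> ring⟩
    (fun _ => relu) (fun _ => hS) 0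
  have h2 := h1.linear (Ψ := fun u (r : Fin n) => u (r, true) - u (r, false))
    ⟨fun u v => by funext r; simp only [Pi.add_apply]; ring,
      fun c u => by funext r; simp only [Pi.smul_apply, smul_eq_mul]; ring⟩
  have e : ∀ y : ℝ, relu y - relu (-y) = y := fun y => by
    rcases le_total y 0 with h | h <;> simp [relu, h]
  simpa [e] using h2

end Nets

/-! ### Approximation of one-variable functions by superpositions. -/

/-- Under the activation assumption, a function that is Lipschitz on `[0, B]` is approximated there
by superpositions of activation functions whose number is linear in the inverse accuracy. -/
def ApproximatesLipschitz (S : Set (ℝ → ℝ)) (C : ℝ) : Prop :=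
  ∀ (B L δ : ℝ) (φ : ℝ → ℝ) (M : ℕ), 0 < B → 0 ≤ L → 0 < δ →
    (∀ x ∈ Set.Icc 0 B, ∀ y ∈ Set.Icc 0 B, |φ x - φ y| ≤ L * |x - y|) →
    C * (B * L / δ) + 1 ≤ M →
    ∃ g, IsSuperposition S M g ∧ ∀ x, |g x - φ (min |x| B)| ≤ δ

theorem ActivationAssumption.approximatesLipschitz {σ : ℝ → ℝ} (hσ : ActivationAssumption σ) :
    ∃ C : ℝ, 0 < C ∧ ∀ S : Set (ℝ → ℝ), σ ∈ S → relu ∈ S → ApproximatesLipschitz S C := by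
  obtain ⟨-, C, hC, H⟩ := hσ
  refine ⟨C, hC, fun S hσS hS B L δ φ M hB hL hδ hφ hM => ?_⟩
  have hmem : ∀ x : ℝ, min |x| B ∈ Set.Icc 0 B := fun x =>
    ⟨le_min (abs_nonneg x) hB.le, min_le_right _ _⟩
  -- Reflecting at `0` and clamping at `B` extends `φ` to a function on the line that has the same
  -- Lipschitz constant and is constant outside `[-B, B]`.
  have hlip : LipschitzWith ⟨L, hL⟩ (fun x => φ (min |x| B)) := by
    refine LipschitzWith.of_dist_le_mul fun x y => ?_
    rw [Real.dist_eq, Real.dist_eq]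
    refine (hφ _ (hmem x) _ (hmem y)).trans (mul_le_mul_of_nonneg_left ?_ hL)
    have h1 : |min |x| B - min |y| B| ≤ |(|x| - |y|)| := by
      have := abs_min_sub_min_le_max |x| B |y| B
      simpa using this
    exact h1.trans (abs_abs_sub_abs_le x y)
  obtain ⟨m, a, α, β, γ, hm, happ⟩ := H ⟨L, hL⟩ B δ _ hB hδ hlip ⟨φ B, fun x hx => by
    have hx' : B ≤ |x| := by
      by_contra! h
      exact hx ⟨(abs_lt.1 h).1.le, (abs_lt.1 h).2.le⟩
    simp [hx']⟩
  refine ⟨fun x => a + ∑ i, α i * σ (β i * x + γ i), ?_, happ⟩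
  have hs : IsSuperposition S m (fun x => ∑ i, α i * σ (β i * x + γ i)) :=
    ⟨fun _ => σ, α, β, γ, fun _ => hσS, fun _ => rfl⟩
  -- The constant `a` takes one ReLU, which is the `+ 1` in the bound on `M`.
  refine ((isSuperposition_const hS a).add hs).mono hS ?_
  have : (m : ℝ) + 1 ≤ M := by
    have h1 : (m : ℝ) ≤ C * (B * L / δ) := hm
    linarith
  have : m + 1 ≤ M := by exact_mod_cast this
  omega

theorem abs_exp_neg_sub_exp_neg_le {x y : ℝ} (hx : 0 ≤ x) (hy : 0 ≤ y) :
    |Real.exp (-x) - Real.exp (-y)| ≤ |x - y| := by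
  wlog h : x ≤ y generalizing x y
  · rw [abs_sub_comm, abs_sub_comm x]
    exact this hy hx (le_of_not_ge h)
  have h1 : Real.exp (-y) ≤ Real.exp (-x) := Real.exp_le_exp.2 (by linarith)
  rw [abs_of_nonneg (by linarith), abs_of_nonpos (by linarith)]
  have h2 : Real.exp (-y) = Real.exp (-x) * Real.exp (-(y - x)) := by
    rw [← Real.exp_add]; ring_nf
  have h3 := Real.add_one_le_exp (-(y - x))
  have h4 : Real.exp (-x) ≤ 1 := Real.exp_le_one_iff.2 (by linarith)
  have h5 := Real.exp_pos (-x)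
  rw [h2]
  nlinarith

/-- The square root is not Lipschitz at `0`. Its regularization `√(x + η²)` is, with constant `1 /
(2η)`, at the price of an error `η`. -/
theorem abs_sqrt_add_sq_sub_sqrt_le {x η : ℝ} (hx : 0 ≤ x) (hη : 0 ≤ η) :
    |√(x + η ^ 2) - √x| ≤ η := by
  rw [abs_of_nonneg (sub_nonneg.2 (Real.sqrt_le_sqrt (by nlinarith)))]
  have : √(x + η ^ 2) ≤ √x + η := by
    rw [Real.sqrt_le_left (by positivity)]
    nlinarith [Real.sq_sqrt hx, mul_nonneg (Real.sqrt_nonneg x) hη]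
  linarith

theorem abs_sqrt_add_sq_sub_sqrt_add_sq_le {x y η : ℝ} (hx : 0 ≤ x) (hy : 0 ≤ y) (hη : 0 < η) :
    |√(x + η ^ 2) - √(y + η ^ 2)| ≤ |x - y| / (2 * η) := by
  have h1 : ∀ {z : ℝ}, 0 ≤ z → η ≤ √(z + η ^ 2) := fun hz =>
    Real.le_sqrt_of_sq_le (by linarith)
  rw [le_div_iff₀ (by positivity)]
  have e : x - y = (√(x + η ^ 2) - √(y + η ^ 2)) * (√(x + η ^ 2) + √(y + η ^ 2)) := by
    have hx2 := Real.sq_sqrt (show 0 ≤ x + η ^ 2 by positivity)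
    have hy2 := Real.sq_sqrt (show 0 ≤ y + η ^ 2 by positivity)
    linear_combination hy2 - hx2
  rw [e, abs_mul]
  refine mul_le_mul_of_nonneg_left ?_ (abs_nonneg _)
  refine le_trans ?_ (le_abs_self _)
  linarith [h1 hx, h1 hy]

theorem abs_log_max_sub_log_max_le {c x y : ℝ} (hc : 0 < c) :
    |Real.log (max c x) - Real.log (max c y)| ≤ 1 / c * |x - y| := by
  wlog h : y ≤ x generalizing x y
  · rw [abs_sub_comm, abs_sub_comm x]
    exact this (le_of_not_ge h)
  have hy : 0 < max c y := lt_max_of_lt_left hc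
  have hx : 0 < max c x := lt_max_of_lt_left hc
  have hxy : max c y ≤ max c x := max_le_max le_rfl h
  rw [abs_of_nonneg (sub_nonneg.2 (Real.log_le_log hy hxy)), abs_of_nonneg (by linarith),
    ← Real.log_div hx.ne' hy.ne']
  have h1 := Real.log_le_sub_one_of_pos (div_pos hx hy)
  have h2 : max c x - max c y ≤ x - y := by
    rcases max_cases c x with ⟨h, _⟩ | ⟨h, _⟩ <;> rcases max_cases c y with ⟨h', _⟩ | ⟨h', _⟩ <;>
      rw [h, h'] <;> linarith
  have h3 : max c x / max c y - 1 = (max c x - max c y) / max c y := by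
    field_simp
  have h4 : (max c x - max c y) / max c y ≤ (x - y) / c :=
    div_le_div₀ (by linarith) h2 hc (le_max_left _ _)
  calc _ ≤ (x - y) / c := by linarith
    _ = _ := by ring

section Approximants

variable {S : Set (ℝ → ℝ)} {C : ℝ}

theorem ApproximatesLipschitz.exp_neg (hS : ApproximatesLipschitz S C) {δ : ℝ} (hδ : 0 < δ)
    {M : ℕ} (hM : C * (1 / δ) + 1 ≤ M) :
    ∃ g, IsSuperposition S M g ∧ ∀ t ∈ Set.Icc (0 : ℝ) 1, |g t - Real.exp (-t)| ≤ δ := by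
  obtain ⟨g, hg, h⟩ := hS 1 1 δ (fun t => Real.exp (-t)) M one_pos zero_le_one hδ
    (fun x hx y hy => by simpa using abs_exp_neg_sub_exp_neg_le hx.1 hy.1) (by simpa using hM)
  refine ⟨g, hg, fun t ht => ?_⟩
  simpa [abs_of_nonneg ht.1, min_eq_left ht.2] using h t

theorem ApproximatesLipschitz.sqrt_one_sub_exp (hS : ApproximatesLipschitz S C) {δ : ℝ}
    (hδ : 0 < δ) {M : ℕ} (hM : C * (4 / δ ^ 2) + 1 ≤ M) :
    ∃ g, IsSuperposition S M g ∧
      ∀ t ∈ Set.Icc (0 : ℝ) 1, |g t - √(1 - Real.exp (-2 * t))| ≤ δ := by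
  have hnn : ∀ t : ℝ, 0 ≤ t → 0 ≤ 1 - Real.exp (-2 * t) := fun t ht =>
    sub_nonneg.2 (Real.exp_le_one_iff.2 (by linarith))
  -- Regularization with `η = δ/2`: the Lipschitz constant is `2 / (2η) = 2/δ`, and half of the
  -- accuracy remains for the superposition, whence the cost `4/δ²`.
  obtain ⟨g, hg, h⟩ := hS 1 (2 / δ) (δ / 2) (fun t => √(1 - Real.exp (-2 * t) + (δ / 2) ^ 2)) M
    one_pos (by positivity) (by positivity) (fun x hx y hy => by
      refine (abs_sqrt_add_sq_sub_sqrt_add_sq_le (hnn x hx.1) (hnn y hy.1)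
        (half_pos hδ)).trans ?_
      have h1 := abs_exp_neg_sub_exp_neg_le (x := 2 * y) (y := 2 * x)
        (by linarith [hy.1]) (by linarith [hx.1])
      rw [← mul_sub, abs_mul, abs_two, abs_sub_comm y] at h1
      have h2 : 1 - Real.exp (-2 * x) - (1 - Real.exp (-2 * y)) =
        Real.exp (-(2 * y)) - Real.exp (-(2 * x)) := by ring_nf
      rw [h2, div_le_iff₀ (by positivity)]
      calc _ ≤ 2 * |x - y| := h1
        _ = _ := by field_simp)
    (le_trans (le_of_eq (by field_simp; ring)) hM)
  refine ⟨g, hg, fun t ht => ?_⟩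
  have h1 := h t
  rw [abs_of_nonneg ht.1, min_eq_left ht.2] at h1
  have h2 := abs_sqrt_add_sq_sub_sqrt_le (hnn t ht.1) (half_pos hδ).le
  have h3 := abs_sub_le (g t) (√(1 - Real.exp (-2 * t) + (δ / 2) ^ 2)) (√(1 - Real.exp (-2 * t)))
  linarith

theorem ApproximatesLipschitz.sq (hS : ApproximatesLipschitz S C) {B δ : ℝ} (hB : 0 < B)
    (hδ : 0 < δ) {M : ℕ} (hM : C * (2 * B ^ 2 / δ) + 1 ≤ M) :
    ∃ g, IsSuperposition S M g ∧ ∀ y, |y| ≤ B → |g y - y ^ 2| ≤ δ := by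
  obtain ⟨g, hg, h⟩ := hS B (2 * B) δ (fun y => y ^ 2) M hB (by positivity) hδ
    (fun x hx y hy => by
      rw [sq_sub_sq, abs_mul]
      refine mul_le_mul_of_nonneg_right ?_ (abs_nonneg _)
      rw [abs_of_nonneg (add_nonneg hx.1 hy.1)]
      linarith [hx.2, hy.2])
    (le_trans (le_of_eq (by ring)) hM)
  refine ⟨g, hg, fun y hy => ?_⟩
  simpa [min_eq_left hy] using h y

/-- Approximating `log (max c y)`, which is `1/c`-Lipschitz, leaves `y` unrestricted: an inaccurate
input is paid for by `|y - u| / c`. -/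
theorem ApproximatesLipschitz.log (hS : ApproximatesLipschitz S C) {B c δ : ℝ} (hc : 0 < c)
    (hcB : c ≤ B) (hδ : 0 < δ) {M : ℕ} (hM : C * (B / c / δ) + 1 ≤ M) :
    ∃ g, IsSuperposition S M g ∧
      ∀ y u, u ∈ Set.Icc c B → |g y - Real.log u| ≤ δ + |y - u| / c := by
  obtain ⟨g, hg, h⟩ := hS B (1 / c) δ (fun y => Real.log (max c y)) M (hc.trans_le hcB)
    (by positivity) hδ (fun x _ y _ => abs_log_max_sub_log_max_le hc)
    (le_trans (le_of_eq (by ring)) hM)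
  refine ⟨g, hg, fun y u hu => ?_⟩
  have h1 := abs_log_max_sub_log_max_le (x := min |y| B) (y := u) hc
  have hu0 : 0 ≤ u := hc.le.trans hu.1
  have h2 : |min |y| B - u| ≤ |y - u| := by
    have := abs_min_sub_min_le_max |y| B |u| B
    rw [abs_of_nonneg hu0, min_eq_left hu.2, sub_self, abs_zero,
      max_eq_left (abs_nonneg _)] at this
    refine this.trans ?_
    have h3 := abs_abs_sub_abs_le y u
    rwa [abs_of_nonneg hu0] at h3
  rw [max_eq_right hu.1] at h1
  have h3 := abs_sub_le (g y) (Real.log (max c (min |y| B))) (Real.log u)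
  have h4 : 1 / c * |min |y| B - u| ≤ |y - u| / c := by
    rw [one_div_mul_eq_div]
    gcongr
  linarith [h y]

end Approximants

/-! ### Gaussian moments and truncation of the Gaussian variable. -/

section Gaussian

variable {d : ℕ}

local notation "𝔼" => EuclideanSpace ℝ (Fin d)

theorem integrable_norm_sq_stdGaussian :
    Integrable (fun z : 𝔼 => ‖z‖ ^ 2) (stdGaussian 𝔼) :=
  (IsGaussian.memLp_two_id (μ := stdGaussian 𝔼)).integrable_norm_pow two_ne_zero

theorem integrable_norm_stdGaussian : Integrable (fun z : 𝔼 => ‖z‖) (stdGaussian 𝔼) :=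
  (IsGaussian.integrable_id (μ := stdGaussian 𝔼)).norm

theorem integral_norm_sq_stdGaussian_le : ∫ z : 𝔼, ‖z‖ ^ 2 ∂(stdGaussian 𝔼) ≤ d := by
  have hL2 : ∀ i : Fin d, MemLp (EuclideanSpace.proj (𝕜 := ℝ) i : 𝔼 → ℝ) 2 (stdGaussian 𝔼) :=
    fun i => (EuclideanSpace.proj (𝕜 := ℝ) i).comp_memLp' IsGaussian.memLp_two_id
  have h1 : ∀ i : Fin d, ∫ z : 𝔼, z i ^ 2 ∂(stdGaussian 𝔼) ≤ 1 := by
    intro i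
    have h2 := variance_dual_stdGaussian (E := 𝔼) (EuclideanSpace.proj (𝕜 := ℝ) i)
    rw [variance_eq_sub (hL2 i), integral_strongDual_stdGaussian] at h2
    have h3 : ‖(EuclideanSpace.proj (𝕜 := ℝ) i : 𝔼 →L[ℝ] ℝ)‖ ≤ 1 :=
      ContinuousLinearMap.opNorm_le_bound _ zero_le_one fun z => by
        simpa using PiLp.norm_apply_le z i
    have h4 : ∫ z : 𝔼, z i ^ 2 ∂(stdGaussian 𝔼) =
        ‖(EuclideanSpace.proj (𝕜 := ℝ) i : 𝔼 →L[ℝ] ℝ)‖ ^ 2 := by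
      rw [← h2]; simp
    rw [h4]
    exact pow_le_one₀ (norm_nonneg _) h3
  simp_rw [EuclideanSpace.real_norm_sq_eq]
  have hint : ∀ i : Fin d, Integrable (fun z : 𝔼 => z i ^ 2) (stdGaussian 𝔼) :=
    fun i => (hL2 i).integrable_sq
  rw [integral_finsetSum _ fun i _ => hint i]
  calc _ ≤ ∑ _i : Fin d, (1 : ℝ) := Finset.sum_le_sum fun i _ => h1 i
    _ = d := by simp

theorem integral_norm_stdGaussian_le : ∫ z : 𝔼, ‖z‖ ∂(stdGaussian 𝔼) ≤ d + 1 := by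
  calc ∫ z : 𝔼, ‖z‖ ∂(stdGaussian 𝔼) ≤ ∫ z : 𝔼, (‖z‖ ^ 2 + 1) ∂(stdGaussian 𝔼) := by
        refine integral_mono integrable_norm_stdGaussian
          (integrable_norm_sq_stdGaussian.add (integrable_const _)) fun z => ?_
        change ‖z‖ ≤ ‖z‖ ^ 2 + 1
        nlinarith [sq_nonneg (‖z‖ - 1), norm_nonneg z]
    _ ≤ d + 1 := by
        rw [integral_add integrable_norm_sq_stdGaussian (integrable_const _)]
        simpa using integral_norm_sq_stdGaussian_le

/-- The vector `z`, replaced by `0` outside the ball of radius `ρ`. -/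
noncomputable def truncate (ρ : ℝ) (z : 𝔼) : 𝔼 := if ‖z‖ ≤ ρ then z else 0

theorem norm_truncate_le {ρ : ℝ} (hρ : 0 ≤ ρ) (z : 𝔼) : ‖truncate ρ z‖ ≤ ρ := by
  unfold truncate
  split_ifs with h
  · exact h
  · simpa using hρ

theorem measurable_truncate (ρ : ℝ) : Measurable (truncate ρ : 𝔼 → 𝔼) :=
  Measurable.ite (measurableSet_le measurable_norm measurable_const) measurable_id
    measurable_const

/-- Outside the ball `‖z‖ > ρ`, so `‖z‖ ≤ ‖z‖²/ρ`. Truncation bounds the random variables, as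
Hoeffding's inequality requires, and costs only the second moment divided by `ρ`. -/
theorem norm_sub_truncate_le {ρ : ℝ} (hρ : 0 < ρ) (z : 𝔼) :
    ‖z - truncate ρ z‖ ≤ ‖z‖ ^ 2 / ρ := by
  unfold truncate
  split_ifs with h
  · simp; positivity
  · rw [sub_zero, le_div_iff₀ hρ]
    nlinarith [norm_nonneg z]

theorem LipschitzWith.abs_sub_le {L : ℝ≥0} {f : 𝔼 → ℝ} (hf : LipschitzWith L f) (x y : 𝔼) :
    |f x - f y| ≤ L * ‖x - y‖ := by
  simpa [Real.dist_eq, dist_eq_norm] using hf.dist_le_mul x y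

theorem LipschitzWith.integrable_comp_affine {L : ℝ≥0} {f : 𝔼 → ℝ} (hf : LipschitzWith L f)
    (a : 𝔼) (s : ℝ) : Integrable (fun z => f (a + s • z)) (stdGaussian 𝔼) := by
  have hb : Integrable (fun z : 𝔼 => |f a| + L * (|s| * ‖z‖)) (stdGaussian 𝔼) :=
    (integrable_const _).add ((integrable_norm_stdGaussian.const_mul _).const_mul _)
  have hc : Continuous (fun z : 𝔼 => a + s • z) := by fun_prop
  refine hb.mono' (hf.continuous.comp hc).aestronglyMeasurable (.of_forall fun z => ?_)
  have h1 := hf.abs_sub_le (a + s • z) a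
  rw [add_sub_cancel_left, norm_smul, Real.norm_eq_abs] at h1
  have h2 := abs_add_le (f (a + s • z) - f a) (f a)
  rw [sub_add_cancel] at h2
  rw [Real.norm_eq_abs]
  linarith

theorem LipschitzWith.measurable_comp_truncate {L : ℝ≥0} {f : 𝔼 → ℝ} (hf : LipschitzWith L f)
    (ρ : ℝ) (a : 𝔼) (s : ℝ) : Measurable (fun z => f (a + s • truncate ρ z)) :=
  hf.continuous.measurable.comp (((measurable_truncate ρ).const_smul s).const_add a)

theorem LipschitzWith.abs_comp_truncate_sub_le {L : ℝ≥0} {f : 𝔼 → ℝ} (hf : LipschitzWith L f)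
    {ρ : ℝ} (hρ : 0 ≤ ρ) (a : 𝔼) {s : ℝ} (hs : |s| ≤ 1) (z : 𝔼) :
    |f (a + s • truncate ρ z) - f a| ≤ L * ρ := by
  refine (hf.abs_sub_le _ _).trans ?_
  rw [add_sub_cancel_left, norm_smul, Real.norm_eq_abs]
  gcongr
  calc |s| * ‖truncate ρ z‖ ≤ 1 * ρ :=
        mul_le_mul hs (norm_truncate_le hρ z) (norm_nonneg _) zero_le_one
    _ = ρ := one_mul ρ

theorem LipschitzWith.integrable_comp_truncate {L : ℝ≥0} {f : 𝔼 → ℝ} (hf : LipschitzWith L f)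
    {ρ : ℝ} (hρ : 0 ≤ ρ) (a : 𝔼) {s : ℝ} (hs : |s| ≤ 1) :
    Integrable (fun z => f (a + s • truncate ρ z)) (stdGaussian 𝔼) := by
  refine (integrable_const (|f a| + L * ρ)).mono'
    (hf.measurable_comp_truncate ρ a s).aestronglyMeasurable (.of_forall fun z => ?_)
  have h1 := hf.abs_comp_truncate_sub_le hρ a hs z
  have h2 := abs_add_le (f (a + s • truncate ρ z) - f a) (f a)
  rw [sub_add_cancel] at h2
  rw [Real.norm_eq_abs]
  linarith

theorem LipschitzWith.abs_integral_sub_integral_truncate_le {L : ℝ≥0} {f : 𝔼 → ℝ}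
    (hf : LipschitzWith L f) {ρ : ℝ} (hρ : 0 < ρ) (a : 𝔼) {s : ℝ} (hs : |s| ≤ 1) :
    |∫ z, f (a + s • truncate ρ z) ∂(stdGaussian 𝔼) - ∫ z, f (a + s • z) ∂(stdGaussian 𝔼)| ≤
      L * (d / ρ) := by
  rw [← integral_sub (hf.integrable_comp_truncate hρ.le a hs) (hf.integrable_comp_affine a s)]
  refine (abs_integral_le_integral_abs).trans ?_
  calc _ ≤ ∫ z : 𝔼, L * (‖z‖ ^ 2 / ρ) ∂(stdGaussian 𝔼) := by
        refine integral_mono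
          ((hf.integrable_comp_truncate hρ.le a hs).sub (hf.integrable_comp_affine a s)).abs
          ((integrable_norm_sq_stdGaussian.div_const ρ).const_mul _) fun z => ?_
        refine (hf.abs_sub_le _ _).trans ?_
        rw [add_sub_add_left_eq_sub, ← smul_sub, norm_smul, norm_sub_rev, Real.norm_eq_abs]
        gcongr
        calc |s| * ‖z - truncate ρ z‖ ≤ 1 * (‖z‖ ^ 2 / ρ) :=
              mul_le_mul hs (norm_sub_truncate_le hρ z) (norm_nonneg _) zero_le_one
          _ = _ := one_mul _
    _ = L * ((∫ z : 𝔼, ‖z‖ ^ 2 ∂(stdGaussian 𝔼)) / ρ) := by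
        rw [integral_const_mul, integral_div]
    _ ≤ L * (d / ρ) := by
        gcongr
        exact integral_norm_sq_stdGaussian_le

end Gaussian

/-! ### A single sample that works uniformly. -/

/-- Hoeffding's inequality with a union bound: finitely many means of bounded functions are
simultaneously approximated by the averages over a suitable sample. -/
theorem exists_sample_forall_abs_average_sub_integral_le {Ω G : Type*} [MeasurableSpace Ω]
    [Fintype G] (P : Measure Ω) [IsProbabilityMeasure P] {X : G → Ω → ℝ} {m : G → ℝ} {b δ : ℝ}
    (hX : ∀ u, Measurable (X u)) (hb : 0 < b) (hXb : ∀ u ω, |X u ω - m u| ≤ b) (hδ : 0 < δ)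
    {n : ℕ} (hn : 0 < n)
    (hcard : 2 * Fintype.card G * Real.exp (-(n * δ ^ 2 / (2 * b ^ 2))) < 1) :
    ∃ ω : Fin n → Ω, ∀ u, |(∑ j, X u (ω j)) / n - ∫ y, X u y ∂P| ≤ δ := by
  classical
  set μ : Measure (Fin n → Ω) := Measure.pi fun _ => P with hμ
  have hn' : (0 : ℝ) < n := by exact_mod_cast hn
  -- One-sided tail bound: values in an interval of length `2b` are sub-Gaussian with parameter
  -- `b²`, by Hoeffding's lemma.
  have key : ∀ Y : Ω → ℝ, Measurable Y → ∀ m : ℝ, (∀ ω, |Y ω - m| ≤ b) →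
      μ.real {ω | n * δ ≤ ∑ j, (Y (ω j) - ∫ y, Y y ∂P)} ≤
        Real.exp (-(n * δ ^ 2 / (2 * b ^ 2))) := by
    intro Y hY m hYb
    have hind : iIndepFun (fun (j : Fin n) (ω : Fin n → Ω) => Y (ω j) - ∫ y, Y y ∂P) μ :=
      iIndepFun_pi (μ := fun _ : Fin n => P) (X := fun _ ω => Y ω - ∫ y, Y y ∂P)
        fun _ => (hY.sub_const _).aemeasurable
    have hsub : HasSubgaussianMGF (fun ω => Y ω - ∫ y, Y y ∂P)
        ((‖(m + b) - (m - b)‖₊ / 2) ^ 2) P :=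
      hasSubgaussianMGF_of_mem_Icc hY.aemeasurable (.of_forall fun ω => by
        have := abs_le.1 (hYb ω)
        constructor <;> linarith)
    have hsub' : ∀ j ∈ (Finset.univ : Finset (Fin n)),
        HasSubgaussianMGF (fun ω : Fin n → Ω => Y (ω j) - ∫ y, Y y ∂P)
          ((‖(m + b) - (m - b)‖₊ / 2) ^ 2) μ := by
      intro j _
      have hmp := measurePreserving_eval (fun _ : Fin n => P) j
      refine HasSubgaussianMGF.of_map (Y := fun ω : Fin n → Ω => ω j)
        (X := fun ω => Y ω - ∫ y, Y y ∂P) hmp.measurable.aemeasurable ?_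
      have : Measure.map (fun ω : Fin n → Ω => ω j) μ = P := hmp.map_eq
      rw [this]
      exact hsub
    have h := HasSubgaussianMGF.measure_sum_ge_le_of_iIndepFun hind hsub'
      (ε := n * δ) (by positivity)
    refine h.trans (le_of_eq ?_)
    have hc : ((((‖(m + b) - (m - b)‖₊ / 2) ^ 2 : ℝ≥0)) : ℝ) = b ^ 2 := by
      push_cast
      rw [Real.norm_eq_abs, show (m + b) - (m - b) = 2 * b by ring, abs_of_pos (by positivity)]
      ring
    congr 1
    push_cast at hc ⊢
    rw [hc]
    simp only [Finset.sum_const, Finset.card_univ, Fintype.card_fin, nsmul_eq_mul]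
    field_simp
  -- The Boolean chooses the sign, so both tails are covered; this is the factor `2` in `hcard`. The
  -- bad events have total probability below `1`, so some sample avoids them all.
  set bad : G × Bool → Set (Fin n → Ω) := fun q =>
    {ω | n * δ ≤ ∑ j, ((bif q.2 then X q.1 (ω j) else - X q.1 (ω j)) -
      ∫ y, (bif q.2 then X q.1 y else - X q.1 y) ∂P)} with hbad
  have hbadle : ∀ q, μ.real (bad q) ≤ Real.exp (-(n * δ ^ 2 / (2 * b ^ 2))) := by
    rintro ⟨u, _ | _⟩
    · exact key (fun ω => - X u ω) (hX u).neg (- m u) fun ω => by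
        rw [← neg_add', abs_neg]
        simpa [sub_eq_add_neg] using hXb u ω
    · exact key (fun ω => X u ω) (hX u) (m u) (hXb u)
  have hne : ⋃ q, bad q ≠ Set.univ := by
    intro h
    have h1 : μ.real (⋃ q, bad q) ≤ ∑ q, μ.real (bad q) := measureReal_iUnion_fintype_le _
    rw [h, probReal_univ] at h1
    have h2 : ∑ q, μ.real (bad q) ≤
        ∑ _q : G × Bool, Real.exp (-(n * δ ^ 2 / (2 * b ^ 2))) :=
      Finset.sum_le_sum fun q _ => hbadle q
    simp only [Finset.sum_const, Finset.card_univ, Fintype.card_prod, Fintype.card_bool,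
      nsmul_eq_mul] at h2
    push_cast at h2
    linarith
  obtain ⟨ω, hω⟩ := (Set.ne_univ_iff_exists_notMem _).1 hne
  simp only [Set.mem_iUnion, not_exists] at hω
  refine ⟨ω, fun u => ?_⟩
  have h1 := hω (u, true)
  have h2 := hω (u, false)
  simp only [hbad, Set.mem_ofPred_eq, not_le, cond_true, cond_false, integral_neg,
    Finset.sum_sub_distrib, Finset.sum_neg_distrib, Finset.sum_const, Finset.card_univ,
    Fintype.card_fin, nsmul_eq_mul] at h1 h2
  have h3 : (∑ j, X u (ω j)) / n - ∫ y, X u y ∂P =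
      (∑ j, X u (ω j) - n * ∫ y, X u y ∂P) / n := by field_simp
  rw [h3, abs_div, abs_of_pos hn', div_le_iff₀ hn', abs_le]
  constructor <;> nlinarith

/-- A uniform grid of `k + 1` points in `[-A, A]`. -/
theorem exists_grid_abs_sub_le {A x : ℝ} (hx : |x| ≤ A) {k : ℕ} (hk : 0 < k) :
    ∃ j : Fin (k + 1), |x - (-A + 2 * A * j / k)| ≤ 2 * A / k := by
  have hA : 0 ≤ A := (abs_nonneg x).trans hx
  obtain ⟨h1, h2⟩ := abs_le.1 hx
  have hk' : (0 : ℝ) < k := by exact_mod_cast hk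
  rcases hA.eq_or_lt with rfl | hA
  · exact ⟨0, by simp; linarith⟩
  set y : ℝ := (x + A) * k / (2 * A) with hy
  have hy0 : 0 ≤ y := div_nonneg (mul_nonneg (by linarith) hk'.le) (by linarith)
  have hyk : y ≤ k := by
    rw [hy, div_le_iff₀ (by positivity)]
    nlinarith
  have hfl : ⌊y⌋₊ ≤ k := Nat.floor_le_of_le hyk
  refine ⟨⟨⌊y⌋₊, by omega⟩, ?_⟩
  have e : x - (-A + 2 * A * (⌊y⌋₊ : ℝ) / k) = (y - ⌊y⌋₊) * (2 * A / k) := by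
    rw [hy]; field_simp; ring
  simp only [e]
  rw [abs_mul, abs_of_nonneg (sub_nonneg.2 (Nat.floor_le hy0)), abs_of_pos (by positivity)]
  have := Nat.lt_floor_add_one y
  have h3 : y - ⌊y⌋₊ ≤ 1 := by linarith
  calc _ ≤ 1 * (2 * A / k) := by gcongr
    _ = _ := one_mul _

theorem EuclideanSpace.norm_le_sum_abs {d : ℕ} (x : EuclideanSpace ℝ (Fin d)) :
    ‖x‖ ≤ ∑ i, |x i| := by
  rw [EuclideanSpace.norm_eq]
  refine Real.sqrt_le_iff.2 ⟨Finset.sum_nonneg fun i _ => abs_nonneg _, ?_⟩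
  simpa using Finset.sum_sq_le_sq_sum_of_nonneg (s := Finset.univ) (f := fun i => |x i|)
    fun i _ => abs_nonneg _

section Sample

variable {d : ℕ}

local notation "𝔼" => EuclideanSpace ℝ (Fin d)

/-- The crude bound `k + 1 ≤ e^k` turns the cardinality of the grid into an exponent linear in `k (d
+ 1)`; hence the sample size is polynomial. -/
theorem two_mul_pow_mul_exp_neg_lt_one {k d : ℕ} {r : ℝ} (h : 1 + (k : ℝ) * (d + 1) < r) :
    2 * ((k + 1 : ℝ) ^ d * (k + 1)) * Real.exp (-r) < 1 := by
  have h1 : (k + 1 : ℝ) ≤ Real.exp k := Real.add_one_le_exp _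
  have h2 : (2 : ℝ) ≤ Real.exp 1 := by linarith [Real.add_one_le_exp (1 : ℝ)]
  have h3 : 2 * ((k + 1 : ℝ) ^ d * (k + 1)) ≤ Real.exp (1 + k * (d + 1)) := by
    calc 2 * ((k + 1 : ℝ) ^ d * (k + 1)) = 2 * (k + 1 : ℝ) ^ (d + 1) := by ring
      _ ≤ Real.exp 1 * Real.exp k ^ (d + 1) := by gcongr
      _ = Real.exp (1 + k * (d + 1)) := by
        rw [← Real.exp_nat_mul, ← Real.exp_add]; congr 1; push_cast; ring
  calc _ ≤ Real.exp (1 + k * (d + 1)) * Real.exp (-r) := by gcongr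
    _ = Real.exp (1 + k * (d + 1) - r) := by rw [← Real.exp_add]; ring_nf
    _ < 1 := Real.exp_lt_one_iff.2 (by linarith)

/-- Gaussian averages of a Lipschitz function over all affine images `a + s • Z` with `‖a‖ ≤ A` and
`|s| ≤ 1` are uniformly approximated by averages over a sample whose cardinality is polynomial. -/
theorem LipschitzWith.exists_uniform_sample {L : ℝ≥0} {f : 𝔼 → ℝ} (hf : LipschitzWith L f)
    (hL : 0 < L) {A δ ρ : ℝ} (hA : 0 < A) (hδ : 0 < δ) (hρ : 4 * L * d / δ + 1 ≤ ρ) :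
    ∃ n : ℕ, 0 < n ∧ (n : ℝ) ≤ (1 + (8 * L * (2 * d * A + 2 * ρ) / δ + 2) * (d + 1)) *
        (32 * L ^ 2 * ρ ^ 2 / δ ^ 2) + 2 ∧
      ∃ z : Fin n → 𝔼, (∀ j, ‖z j‖ ≤ ρ) ∧ ∀ a, ‖a‖ ≤ A → ∀ s : ℝ, |s| ≤ 1 →
        |(∑ j, f (a + s • z j)) / n - ∫ z, f (a + s • z) ∂(stdGaussian 𝔼)| ≤ δ := by
  have hL' : (0 : ℝ) < L := hL
  have hρ0 : 0 < ρ := lt_of_lt_of_le (by positivity) hρ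
  -- Mesh size: rounding `(a, s)` to the grid moves the argument by at most `(2dA + 2ρ)/k`, so this
  -- `k` makes the change of `f` at most `δ/8`.
  set k : ℕ := ⌈8 * L * (2 * d * A + 2 * ρ) / δ⌉₊ + 1 with hk
  have hk0 : 0 < k := Nat.succ_pos _
  have hk1 : 8 * L * (2 * d * A + 2 * ρ) / δ ≤ k := by
    rw [hk]; push_cast
    linarith [Nat.le_ceil (8 * L * (2 * d * A + 2 * ρ) / δ)]
  have hk2 : (k : ℝ) ≤ 8 * L * (2 * d * A + 2 * ρ) / δ + 2 := by
    rw [hk]; push_cast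
    linarith [Nat.ceil_lt_add_one (show 0 ≤ 8 * L * (2 * d * A + 2 * ρ) / δ by positivity)]
  -- Hoeffding's exponent with range bound `Lρ` and accuracy `δ/4` exceeds `1 + k (d + 1)` exactly
  -- when `n > r`.
  set r : ℝ := (1 + k * (d + 1)) * (32 * L ^ 2 * ρ ^ 2 / δ ^ 2) with hr
  set n : ℕ := ⌈r⌉₊ + 1 with hn
  have hn0 : 0 < n := Nat.succ_pos _
  have hn1 : r < n := by
    rw [hn]; push_cast
    linarith [Nat.le_ceil r]
  have hn2 : (n : ℝ) ≤ r + 2 := by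
    rw [hn]; push_cast
    linarith [Nat.ceil_lt_add_one (show 0 ≤ r by positivity)]
  have hkR : (0 : ℝ) < k := by exact_mod_cast hk0
  have hnR : (0 : ℝ) < n := by exact_mod_cast hn0
  refine ⟨n, hn0, hn2.trans ?_, ?_⟩
  · rw [hr]; gcongr
  set pt : (Fin d → Fin (k + 1)) → 𝔼 := fun u => WithLp.toLp 2 fun i => -A + 2 * A * (u i) / k
    with hpt
  set sc : Fin (k + 1) → ℝ := fun j => -1 + 2 * 1 * (j : ℝ) / k with hsc
  have hsc1 : ∀ j, |sc j| ≤ 1 := by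
    intro j
    have h1 : (j : ℝ) / k ≤ 1 := by
      rw [div_le_one hkR]
      exact_mod_cast Nat.lt_succ_iff.1 j.2
    have h2 : 0 ≤ (j : ℝ) / k := by positivity
    rw [hsc, abs_le]
    constructor <;> simp only [mul_one, mul_div_assoc] <;> linarith
  obtain ⟨ω, hω⟩ := exists_sample_forall_abs_average_sub_integral_le (stdGaussian 𝔼)
    (G := (Fin d → Fin (k + 1)) × Fin (k + 1))
    (X := fun u z => f (pt u.1 + sc u.2 • truncate ρ z)) (m := fun u => f (pt u.1))
    (b := L * ρ) (δ := δ / 4) (fun u => hf.measurable_comp_truncate ρ _ _) (by positivity)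
    (fun u z => hf.abs_comp_truncate_sub_le hρ0.le _ (hsc1 _) z) (by positivity) hn0 (by
      have h := two_mul_pow_mul_exp_neg_lt_one (k := k) (d := d)
        (r := n * (δ / 4) ^ 2 / (2 * (L * ρ) ^ 2)) (by
          rw [lt_div_iff₀ (by positivity)]
          have h1 : (1 + k * (d + 1)) * (2 * (L * ρ) ^ 2) = r * (δ / 4) ^ 2 := by
            rw [hr]; field_simp; ring
          rw [h1]
          gcongr)
      simpa using h)
  refine ⟨fun j => truncate ρ (ω j), fun j => norm_truncate_le hρ0.le _, fun a ha s hs => ?_⟩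
  have hai : ∀ i, |a i| ≤ A := fun i => by
    have := PiLp.norm_apply_le a i
    rw [Real.norm_eq_abs] at this
    exact this.trans ha
  choose u hu using fun i => exists_grid_abs_sub_le (hai i) hk0
  obtain ⟨j₀, hj₀⟩ := exists_grid_abs_sub_le hs hk0
  have hdist : ∀ w : 𝔼, ‖w‖ ≤ ρ → |f (a + s • w) - f (pt u + sc j₀ • w)| ≤ δ / 8 := by
    intro w hw
    refine (hf.abs_sub_le _ _).trans ?_
    have h1 : a + s • w - (pt u + sc j₀ • w) = (a - pt u) + (s - sc j₀) • w := by
      rw [sub_smul]; abel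
    have h2 : ‖a - pt u‖ ≤ d * (2 * A / k) := by
      refine (EuclideanSpace.norm_le_sum_abs _).trans ?_
      calc _ ≤ ∑ _i : Fin d, 2 * A / k := Finset.sum_le_sum fun i _ => by simpa [hpt] using hu i
        _ = _ := by simp
    have h3 : ‖(s - sc j₀) • w‖ ≤ 2 * 1 / k * ρ := by
      rw [norm_smul, Real.norm_eq_abs]
      exact mul_le_mul hj₀ hw (norm_nonneg _) (by positivity)
    rw [h1]
    calc (L : ℝ) * ‖(a - pt u) + (s - sc j₀) • w‖
        ≤ L * (d * (2 * A / k) + 2 * 1 / k * ρ) := by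
          gcongr
          exact (norm_add_le _ _).trans (add_le_add h2 h3)
      _ = 8 * L * (2 * d * A + 2 * ρ) / δ * (δ / (8 * k)) := by field_simp
      _ ≤ k * (δ / (8 * k)) := by gcongr
      _ = δ / 8 := by field_simp
  have e1 : |(∑ j, f (a + s • truncate ρ (ω j))) / n -
      (∑ j, f (pt u + sc j₀ • truncate ρ (ω j))) / n| ≤ δ / 8 := by
    rw [← sub_div, ← Finset.sum_sub_distrib, abs_div, abs_of_pos hnR, div_le_iff₀ hnR]
    calc _ ≤ ∑ _j : Fin n, δ / 8 :=
          (Finset.abs_sum_le_sum_abs _ _).trans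
            (Finset.sum_le_sum fun j _ => hdist _ (norm_truncate_le hρ0.le _))
      _ = _ := by simp; ring
  have e2 := hω (u, j₀)
  have e3 : |∫ z, f (pt u + sc j₀ • truncate ρ z) ∂(stdGaussian 𝔼) -
      ∫ z, f (a + s • truncate ρ z) ∂(stdGaussian 𝔼)| ≤ δ / 8 := by
    have hi1 := hf.integrable_comp_truncate hρ0.le (pt u) (hsc1 j₀)
    have hi2 := hf.integrable_comp_truncate hρ0.le a hs
    rw [← integral_sub hi1 hi2]
    refine abs_integral_le_integral_abs.trans ?_
    calc _ ≤ ∫ _z : 𝔼, δ / 8 ∂(stdGaussian 𝔼) :=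
          integral_mono (hi1.sub hi2).abs (integrable_const _) fun z =>
            (abs_sub_comm _ _).trans_le (hdist _ (norm_truncate_le hρ0.le z))
      _ = _ := by simp
  have e4 := hf.abs_integral_sub_integral_truncate_le hρ0 a hs
  have e5 : (L : ℝ) * (d / ρ) ≤ δ / 4 := by
    rw [← mul_div_assoc, div_le_iff₀ hρ0]
    have h1 : 4 * L * d / δ ≤ ρ := by linarith
    rw [div_le_iff₀ hδ] at h1
    linarith
  -- Error budget: rounding twice `δ/8`, sampling `δ/4`, truncation `δ/4`.
  rw [abs_le] at *
  constructor <;> linarith [e1.1, e1.2, e2.1, e2.2, e3.1, e3.2, e4.1, e4.2]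

end Sample

/-! ### Regularity of the semigroup and of its logarithmic gradient. -/

section Semigroup

variable {d : ℕ} {L : ℝ≥0} {f : EuclideanSpace ℝ (Fin d) → ℝ}

local notation "𝔼" => EuclideanSpace ℝ (Fin d)

/-- The derivative of `U_t f`. -/
noncomputable def ouFDeriv (t : ℝ) (f : 𝔼 → ℝ) (y : 𝔼) : 𝔼 →L[ℝ] ℝ :=
  ∫ z, Real.exp (-t) • fderiv ℝ f (Real.exp (-t) • y + √(1 - Real.exp (-2 * t)) • z)
    ∂(stdGaussian 𝔼)

theorem lipschitzWith_fderiv (hg : LipschitzWith L (gradient f)) :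
    LipschitzWith L (fderiv ℝ f) := by
  have h : fderiv ℝ f = fun x => InnerProductSpace.toDual ℝ 𝔼 (gradient f x) := by
    funext x; simp [gradient]
  rw [h]
  simpa using (InnerProductSpace.toDual ℝ 𝔼).lipschitz.comp hg

theorem norm_exp_smul_fderiv_le (hf : LipschitzWith L f) {t : ℝ} (ht : 0 ≤ t) (x : 𝔼) :
    ‖Real.exp (-t) • fderiv ℝ f x‖ ≤ L := by
  rw [norm_smul, Real.norm_eq_abs, abs_of_pos (Real.exp_pos _)]
  calc _ ≤ 1 * (L : ℝ) := mul_le_mul (Real.exp_le_one_iff.2 (by linarith))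
        (norm_fderiv_le_of_lipschitz ℝ hf) (norm_nonneg _) zero_le_one
    _ = L := one_mul _

theorem continuous_exp_smul_fderiv (hg : LipschitzWith L (gradient f)) (t : ℝ) (y : 𝔼) :
    Continuous fun z : 𝔼 => Real.exp (-t) •
      fderiv ℝ f (Real.exp (-t) • y + √(1 - Real.exp (-2 * t)) • z) :=
  ((lipschitzWith_fderiv hg).continuous.comp (show Continuous fun z : 𝔼 =>
    Real.exp (-t) • y + √(1 - Real.exp (-2 * t)) • z by fun_prop)).fun_const_smul _

theorem integrable_exp_smul_fderiv (hf : LipschitzWith L f) (hg : LipschitzWith L (gradient f))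
    {t : ℝ} (ht : 0 ≤ t) (y : 𝔼) :
    Integrable (fun z : 𝔼 => Real.exp (-t) •
      fderiv ℝ f (Real.exp (-t) • y + √(1 - Real.exp (-2 * t)) • z)) (stdGaussian 𝔼) :=
  (integrable_const (L : ℝ)).mono' (continuous_exp_smul_fderiv hg t y).aestronglyMeasurable
    (.of_forall fun _ => norm_exp_smul_fderiv_le hf ht _)

/-- Differentiation under the integral sign; the constant `L` dominates the derivatives. -/
theorem hasFDerivAt_ouSemigroup (hd : Differentiable ℝ f) (hf : LipschitzWith L f)
    (hg : LipschitzWith L (gradient f)) {t : ℝ} (ht : 0 ≤ t) (y : 𝔼) :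
    HasFDerivAt (ouSemigroup t f) (ouFDeriv t f y) y := by
  refine hasFDerivAt_integral_of_dominated_of_fderiv_le (s := Set.univ)
    (F := fun y z => f (Real.exp (-t) • y + √(1 - Real.exp (-2 * t)) • z))
    (F' := fun y z => Real.exp (-t) •
      fderiv ℝ f (Real.exp (-t) • y + √(1 - Real.exp (-2 * t)) • z)) (bound := fun _ => (L : ℝ))
    Filter.univ_mem (.of_forall fun x => (integrable_ouSemigroup hf t x).aestronglyMeasurable)
    (integrable_ouSemigroup hf t y) (continuous_exp_smul_fderiv hg t y).aestronglyMeasurable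
    (.of_forall fun z x _ => norm_exp_smul_fderiv_le hf ht _) (integrable_const _)
    (.of_forall fun z x _ => ?_)
  have h1 : HasFDerivAt (fun x : 𝔼 => Real.exp (-t) • x + √(1 - Real.exp (-2 * t)) • z)
      (Real.exp (-t) • ContinuousLinearMap.id ℝ 𝔼) x :=
    ((hasFDerivAt_id x).const_smul (Real.exp (-t))).add_const _
  have h2 := (hd _).hasFDerivAt.comp x h1
  rwa [ContinuousLinearMap.comp_smul, ContinuousLinearMap.comp_id] at h2

theorem norm_ouFDeriv_le (hf : LipschitzWith L f) {t : ℝ} (ht : 0 ≤ t) (y : 𝔼) :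
    ‖ouFDeriv t f y‖ ≤ L := by
  have := norm_integral_le_of_norm_le_const (μ := stdGaussian 𝔼) (C := (L : ℝ))
    (.of_forall fun z => norm_exp_smul_fderiv_le hf ht
      (Real.exp (-t) • y + √(1 - Real.exp (-2 * t)) • z))
  simpa [ouFDeriv] using this

theorem norm_ouFDeriv_sub_le (hf : LipschitzWith L f) (hg : LipschitzWith L (gradient f)) {t : ℝ}
    (ht : 0 ≤ t) (x y : 𝔼) : ‖ouFDeriv t f x - ouFDeriv t f y‖ ≤ L * ‖x - y‖ := by
  rw [ouFDeriv, ouFDeriv, ← integral_sub (integrable_exp_smul_fderiv hf hg ht x)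
    (integrable_exp_smul_fderiv hf hg ht y)]
  have he : Real.exp (-t) ≤ 1 := Real.exp_le_one_iff.2 (by linarith)
  have := norm_integral_le_of_norm_le_const (μ := stdGaussian 𝔼) (C := L * ‖x - y‖)
    (f := fun z => Real.exp (-t) •
        fderiv ℝ f (Real.exp (-t) • x + √(1 - Real.exp (-2 * t)) • z) - Real.exp (-t) •
        fderiv ℝ f (Real.exp (-t) • y + √(1 - Real.exp (-2 * t)) • z))
    (.of_forall fun z => by
      rw [← smul_sub, norm_smul, Real.norm_eq_abs, abs_of_pos (Real.exp_pos _)]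
      have h1 := (lipschitzWith_fderiv hg).norm_sub_le
        (Real.exp (-t) • x + √(1 - Real.exp (-2 * t)) • z)
        (Real.exp (-t) • y + √(1 - Real.exp (-2 * t)) • z)
      rw [add_sub_add_right_eq_sub, ← smul_sub, norm_smul, Real.norm_eq_abs,
        abs_of_pos (Real.exp_pos _)] at h1
      calc _ ≤ 1 * (L * (1 * ‖x - y‖)) := by
            refine mul_le_mul he (h1.trans ?_) (norm_nonneg _) zero_le_one
            gcongr
        _ = _ := by ring)
  simpa using this

theorem le_ouSemigroup (hf : LipschitzWith L f) {c : ℝ} (hc : ∀ x, c ≤ f x) (t : ℝ) (y : 𝔼) :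
    c ≤ ouSemigroup t f y := by
  have := integral_mono (μ := stdGaussian 𝔼) (integrable_const c)
    (integrable_ouSemigroup hf t y) fun z => hc _
  simpa [ouSemigroup] using this

theorem abs_ouSemigroup_sub_le (hd : Differentiable ℝ f) (hf : LipschitzWith L f)
    (hg : LipschitzWith L (gradient f)) {t : ℝ} (ht : 0 ≤ t) (x y : 𝔼) :
    |ouSemigroup t f x - ouSemigroup t f y| ≤ L * ‖x - y‖ := by
  have := Convex.norm_image_sub_le_of_norm_hasFDerivWithin_le (s := Set.univ) (C := (L : ℝ))
    (fun z _ => (hasFDerivAt_ouSemigroup hd hf hg ht z).hasFDerivWithinAt)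
    (fun z _ => norm_ouFDeriv_le hf ht z) convex_univ (Set.mem_univ y) (Set.mem_univ x)
  simpa using this

theorem abs_sqrt_one_sub_exp_le_one (t : ℝ) : |√(1 - Real.exp (-2 * t))| ≤ 1 := by
  rw [abs_of_nonneg (Real.sqrt_nonneg _)]
  exact Real.sqrt_le_one.2 (by linarith [Real.exp_pos (-2 * t)])

/-- Comparing the integrand with `f z` and using that `f` is a probability density. The bound
supplies the right end of the interval on which `log` is approximated. -/
theorem ouSemigroup_le (hf : LipschitzWith L f) (h1 : ∫ z, f z ∂(stdGaussian 𝔼) = 1) {t : ℝ}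
    (ht : 0 ≤ t) (y : 𝔼) : ouSemigroup t f y ≤ 1 + L * (‖y‖ + 2 * (d + 1)) := by
  have hi := integrable_ouSemigroup hf t y
  have hi1 : Integrable f (stdGaussian 𝔼) := by
    simpa using hf.integrable_comp_affine 0 1
  have hb : ∀ z : 𝔼, f (Real.exp (-t) • y + √(1 - Real.exp (-2 * t)) • z) ≤
      f z + L * (‖y‖ + 2 * ‖z‖) := by
    intro z
    have h2 := (le_abs_self _).trans
      (hf.abs_sub_le (Real.exp (-t) • y + √(1 - Real.exp (-2 * t)) • z) z)
    have h3 : ‖Real.exp (-t) • y + √(1 - Real.exp (-2 * t)) • z - z‖ ≤ ‖y‖ + 2 * ‖z‖ := by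
      refine (norm_sub_le _ _).trans ?_
      have h4 := norm_add_le (Real.exp (-t) • y) (√(1 - Real.exp (-2 * t)) • z)
      rw [norm_smul, norm_smul, Real.norm_eq_abs, Real.norm_eq_abs,
        abs_of_pos (Real.exp_pos _)] at h4
      have h5 := mul_le_of_le_one_left (norm_nonneg y)
        (Real.exp_le_one_iff.2 (show -t ≤ 0 by linarith))
      have h6 := mul_le_of_le_one_left (norm_nonneg z) (abs_sqrt_one_sub_exp_le_one t)
      linarith
    have := mul_le_mul_of_nonneg_left h3 L.coe_nonneg
    linarith
  have hi2 : Integrable (fun z : 𝔼 => L * (‖y‖ + 2 * ‖z‖)) (stdGaussian 𝔼) :=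
    ((integrable_const _).add (integrable_norm_stdGaussian.const_mul 2)).const_mul _
  calc ouSemigroup t f y ≤ ∫ z, (f z + L * (‖y‖ + 2 * ‖z‖)) ∂(stdGaussian 𝔼) :=
        integral_mono hi (hi1.add hi2) hb
    _ = 1 + L * (‖y‖ + 2 * ∫ z : 𝔼, ‖z‖ ∂(stdGaussian 𝔼)) := by
        rw [integral_add hi1 hi2, h1, integral_const_mul,
          integral_add (integrable_const _) (integrable_norm_stdGaussian.const_mul 2),
          integral_const_mul]
        simp
    _ ≤ _ := by
        have := integral_norm_stdGaussian_le (d := d)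
        gcongr

theorem integral_eq_one_of_withDensity (hf : Continuous f) (h0 : ∀ x, 0 ≤ f x)
    (h : IsProbabilityMeasure ((stdGaussian 𝔼).withDensity fun x => ENNReal.ofReal (f x))) :
    ∫ z, f z ∂(stdGaussian 𝔼) = 1 := by
  have h1 := h.measure_univ
  rw [withDensity_apply _ MeasurableSet.univ, Measure.restrict_univ] at h1
  rw [integral_eq_lintegral_of_nonneg_ae (.of_forall h0) hf.aestronglyMeasurable, h1,
    ENNReal.toReal_one]

theorem hasFDerivAt_log_ouSemigroup (hd : Differentiable ℝ f) (hf : LipschitzWith L f)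
    (hg : LipschitzWith L (gradient f)) {c : ℝ} (hc0 : 0 < c) (hc : ∀ x, c ≤ f x) {t : ℝ}
    (ht : 0 ≤ t) (y : 𝔼) :
    HasFDerivAt (fun y => Real.log (ouSemigroup t f y))
      ((ouSemigroup t f y)⁻¹ • ouFDeriv t f y) y :=
  (hasFDerivAt_ouSemigroup hd hf hg ht y).log (hc0.trans_le (le_ouSemigroup hf hc t y)).ne'

theorem gradient_log_ouSemigroup_apply (hd : Differentiable ℝ f) (hf : LipschitzWith L f)
    (hg : LipschitzWith L (gradient f)) {c : ℝ} (hc0 : 0 < c) (hc : ∀ x, c ≤ f x) {t : ℝ}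
    (ht : 0 ≤ t) (y : 𝔼) (i : Fin d) :
    gradient (fun y => Real.log (ouSemigroup t f y)) y i =
      (ouSemigroup t f y)⁻¹ * ouFDeriv t f y (EuclideanSpace.single i 1) := by
  have h := (hasFDerivAt_log_ouSemigroup hd hf hg hc0 hc ht y).fderiv
  have h2 : gradient (fun y => Real.log (ouSemigroup t f y)) y i =
      inner ℝ (gradient (fun y => Real.log (ouSemigroup t f y)) y)
        (EuclideanSpace.single i 1) := by
    rw [EuclideanSpace.inner_single_right]
    simp only [one_mul, conj_trivial]
  rw [h2, gradient, InnerProductSpace.toDual_symm_apply, h]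
  simp

theorem abs_gradient_log_ouSemigroup_apply_le (hd : Differentiable ℝ f) (hf : LipschitzWith L f)
    (hg : LipschitzWith L (gradient f)) {c : ℝ} (hc0 : 0 < c) (hc : ∀ x, c ≤ f x) {t : ℝ}
    (ht : 0 ≤ t) (y : 𝔼) (i : Fin d) :
    |gradient (fun y => Real.log (ouSemigroup t f y)) y i| ≤ L / c := by
  have hU := le_ouSemigroup hf hc t y
  rw [gradient_log_ouSemigroup_apply hd hf hg hc0 hc ht, abs_mul, abs_inv,
    abs_of_pos (hc0.trans_le hU), inv_mul_eq_div]
  have h1 := (ouFDeriv t f y).le_opNorm (EuclideanSpace.single i 1)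
  simp only [PiLp.norm_single, norm_one, mul_one, Real.norm_eq_abs] at h1
  exact div_le_div₀ L.coe_nonneg (h1.trans (norm_ouFDeriv_le hf ht y)) hc0 hU

theorem abs_gradient_log_ouSemigroup_sub_le (hd : Differentiable ℝ f) (hf : LipschitzWith L f)
    (hg : LipschitzWith L (gradient f)) {c : ℝ} (hc0 : 0 < c) (hc : ∀ x, c ≤ f x) {t : ℝ}
    (ht : 0 ≤ t) (x y : 𝔼) (i : Fin d) :
    |gradient (fun y => Real.log (ouSemigroup t f y)) x i -
      gradient (fun y => Real.log (ouSemigroup t f y)) y i| ≤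
      (L / c + L ^ 2 / c ^ 2) * ‖x - y‖ := by
  have hL := L.coe_nonneg
  have hy := abs_gradient_log_ouSemigroup_apply_le hd hf hg hc0 hc ht y i
  rw [gradient_log_ouSemigroup_apply hd hf hg hc0 hc ht] at hy
  rw [gradient_log_ouSemigroup_apply hd hf hg hc0 hc ht,
    gradient_log_ouSemigroup_apply hd hf hg hc0 hc ht]
  have hUx := le_ouSemigroup hf hc t x
  have hx0 := hc0.trans_le hUx
  have hy0 := hc0.trans_le (le_ouSemigroup hf hc t y)
  have hU := abs_ouSemigroup_sub_le hd hf hg ht y x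
  have hD : |ouFDeriv t f x (EuclideanSpace.single i 1) -
      ouFDeriv t f y (EuclideanSpace.single i 1)| ≤ L * ‖x - y‖ := by
    have h1 := (ouFDeriv t f x - ouFDeriv t f y).le_opNorm (EuclideanSpace.single i 1)
    simp only [PiLp.norm_single, norm_one, mul_one, Real.norm_eq_abs] at h1
    exact h1.trans (norm_ouFDeriv_sub_le hf hg ht x y)
  set u := ouSemigroup t f x
  set v := ouSemigroup t f y
  set a := ouFDeriv t f x (EuclideanSpace.single i 1)
  set b := ouFDeriv t f y (EuclideanSpace.single i 1)
  -- A finite quotient rule in which `b` occurs only through `v⁻¹ * b`, already bounded by `L/c`.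
  have e : u⁻¹ * a - v⁻¹ * b = ((a - b) + (v⁻¹ * b) * (v - u)) / u := by
    field_simp; ring
  rw [e, abs_div, abs_of_pos hx0]
  rw [norm_sub_rev] at hU
  have h2 : |(a - b) + (v⁻¹ * b) * (v - u)| ≤ L * ‖x - y‖ + L / c * (L * ‖x - y‖) := by
    refine (abs_add_le _ _).trans (add_le_add hD ?_)
    rw [abs_mul]
    exact mul_le_mul hy hU (abs_nonneg _) (by positivity)
  calc _ ≤ (L * ‖x - y‖ + L / c * (L * ‖x - y‖)) / c :=
        div_le_div₀ (by positivity) h2 hc0 hUx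
    _ = _ := by field_simp

/-- The error of a difference quotient of `log U_t f`. -/
theorem abs_difference_quotient_sub_gradient_le (hd : Differentiable ℝ f)
    (hf : LipschitzWith L f) (hg : LipschitzWith L (gradient f)) {c : ℝ} (hc0 : 0 < c)
    (hc : ∀ x, c ≤ f x) {t : ℝ} (ht : 0 ≤ t) (x : 𝔼) (i : Fin d) {h : ℝ} (hh : 0 < h) :
    |(Real.log (ouSemigroup t f (x + h • EuclideanSpace.single i 1)) -
      Real.log (ouSemigroup t f x)) / h -
      gradient (fun y => Real.log (ouSemigroup t f y)) x i| ≤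
      (L / c + L ^ 2 / c ^ 2) * h := by
  set ψ : ℝ → ℝ := fun r => Real.log (ouSemigroup t f (x + r • EuclideanSpace.single i 1))
  have hψ : ∀ r, HasDerivAt ψ (gradient (fun y => Real.log (ouSemigroup t f y))
      (x + r • EuclideanSpace.single i 1) i) r := by
    intro r
    have h1 : HasDerivAt (fun r : ℝ => x + r • (EuclideanSpace.single i 1 : 𝔼))
        (EuclideanSpace.single i 1) r := by
      simpa using ((hasDerivAt_id r).smul_const (EuclideanSpace.single i 1 : 𝔼)).const_add x
    have h2 := (hasFDerivAt_log_ouSemigroup hd hf hg hc0 hc ht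
      (x + r • EuclideanSpace.single i 1)).comp_hasDerivAt r h1
    rw [gradient_log_ouSemigroup_apply hd hf hg hc0 hc ht]
    exact h2
  -- By the mean value theorem the quotient is the partial derivative at a point within distance `h`
  -- of `x`.
  obtain ⟨ξ, hξ, hs⟩ := exists_hasDerivAt_eq_slope ψ _ hh
    (fun r _ => (hψ r).continuousAt.continuousWithinAt) (fun r _ => hψ r)
  have e0 : ψ 0 = Real.log (ouSemigroup t f x) := by simp [ψ]
  rw [sub_zero, e0] at hs
  change |(ψ h - _) / h - _| ≤ _
  rw [← hs]
  refine (abs_gradient_log_ouSemigroup_sub_le hd hf hg hc0 hc ht _ _ i).trans ?_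
  rw [add_sub_cancel_left, norm_smul, PiLp.norm_single, norm_one, mul_one,
    Real.norm_eq_abs, abs_of_pos hξ.1]
  have := hξ.2.le
  gcongr

end Semigroup

/-! ### The approximating net: size and errors. -/

section Score

variable {d n : ℕ}

local notation "𝔼" => EuclideanSpace ℝ (Fin d)

/-- The approximation of `e^{-t} (x + b) + (1 - e^{-2t})^{1/2} z` computed from approximations
`gE`, `gS` and `gQ` of `e^{-t}`, `(1 - e^{-2t})^{1/2}` and the square function. -/
noncomputable def approxArg (gE gS gQ : ℝ → ℝ) (b z : 𝔼) (x : Fin d → ℝ) (t : ℝ) : Fin d → ℝ :=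
  -- Polarization: `((p + q)² - (p - q)²) / 4 = p q`.
  fun k => (gQ (x k + gE t) - gQ (x k - gE t)) / 4 + gE t * b k + gS t * z k

/-- The sample average of `F` at the approximated arguments. -/
noncomputable def approxAvg (gE gS gQ : ℝ → ℝ) (F : (Fin d → ℝ) → Fin 1 → ℝ) (z : Fin n → 𝔼)
    (b : 𝔼) (x : Fin d → ℝ) (t : ℝ) : ℝ :=
  (∑ j, F (approxArg gE gS gQ b (z j) x t) 0) / n

/-- The truncated difference quotients of the logarithms of the sample averages. -/
noncomputable def approxScore (gE gS gQ gL : ℝ → ℝ) (F : (Fin d → ℝ) → Fin 1 → ℝ)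
    (z : Fin n → 𝔼) (h B : ℝ) (u : Fin (d + 1) → ℝ) : Fin d → ℝ :=
  fun i => max (-B) (min
    ((gL (approxAvg gE gS gQ F z (h • EuclideanSpace.single i 1) (fun k => u k.castSucc)
        (u (Fin.last d))) -
      gL (approxAvg gE gS gQ F z 0 (fun k => u k.castSucc) (u (Fin.last d)))) / h) B)

theorem netOutput_approxScore {S S' : Set (ℝ → ℝ)} (hS : relu ∈ S) (hS' : S' ⊆ S) {M : ℕ}
    (hM : 3 ≤ M) {gE gS gQ gL : ℝ → ℝ} (hE : IsSuperposition S M gE) (hSq : IsSuperposition S M gS)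
    (hQ : IsSuperposition S M gQ) (hL : IsSuperposition S M gL) {ℓ s : ℕ}
    {F : (Fin d → ℝ) → Fin 1 → ℝ} (hF : IsNeuralNet S' d ℓ s 1 F) (hn : 0 < n) (z : Fin n → 𝔼)
    (h : ℝ) {B : ℝ} (hB : 0 ≤ B) :
    NetOutput S (d + 1) ((d + 1) * 2 + (5 * d + 6) * M + (d + 1) * n * s)
      (approxScore gE gS gQ gL F z h B) := by
  have : Nonempty (Fin n) := ⟨⟨0, hn⟩⟩
  have hM0 : 0 < M := by omega
  have hid : IsSuperposition S M (fun y => y) := (isSuperposition_id hS).mono hS (by omega)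
  have h0 := netOutput_id (n := d + 1) hS
  -- The time is mapped to `gE t` and `gS t`, while the coordinates of `x` are carried along by
  -- identity neurons.
  have h1 := h0.superposition hM0 (ν := Fin d ⊕ Bool)
    (Φ := fun u r => r.elim (fun k => u k.castSucc) fun _ => u (Fin.last d))
    ⟨fun u v => by funext r; rcases r with k | c <;> simp,
      fun c u => by funext r; rcases r with k | c <;> simp⟩
    (g := fun r => r.elim (fun _ y => y) fun c => bif c then gE else gS)
    (by rintro (k | _ | _) <;> simp [hid, hE, hSq])
  have h2 := h1.superposition hM0 (ν := (Fin d × Bool) ⊕ Bool)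
    (Φ := fun u r => r.elim
      (fun k => bif k.2 then u (.inl k.1) + u (.inr true) else u (.inl k.1) - u (.inr true))
      fun c => u (.inr c))
    ⟨fun u v => by funext r; rcases r with ⟨k, _ | _⟩ | c <;> simp <;> ring,
      fun c u => by funext r; rcases r with ⟨k, _ | _⟩ | c <;> simp <;> ring⟩
    (g := fun r => r.elim (fun _ => gQ) fun _ y => y)
    (by rintro (k | _) <;> simp [hid, hQ])
  -- In `Option (Fin d)`, `none` stands for the base point and `some i` for its shift by `h` in
  -- direction `i`; each needs all `n` sample points.
  have h3 := h2.copies hS' (Q := Option (Fin d) × Fin n) hF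
    (Φ := fun u q k => (u (.inl (k, true)) - u (.inl (k, false))) / 4 +
      u (.inr true) * (q.1.elim (0 : 𝔼) fun i => h • EuclideanSpace.single i 1) k +
      u (.inr false) * z q.2 k)
    ⟨fun u v => by funext q k; simp only [Pi.add_apply]; ring,
      fun c u => by funext q k; simp only [Pi.smul_apply, smul_eq_mul]; ring⟩
  have h4 := h3.superposition hM0 (ν := Option (Fin d))
    (Φ := fun u o => (∑ j, u ((o, j), 0)) / n)
    ⟨fun u v => by funext o; simp [Finset.sum_add_distrib, add_div],
      fun c u => by funext o; simp [← Finset.mul_sum, mul_div_assoc]⟩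
    (g := fun _ => gL) (fun _ => hL)
  have h5 := h4.superposition hM0 (ν := Option (Fin d))
    (Φ := fun u o => (u o - u none) / h)
    ⟨fun u v => by funext o; simp only [Pi.add_apply]; ring,
      fun c u => by funext o; simp only [Pi.smul_apply, smul_eq_mul]; ring⟩
    (g := fun _ y => max (-B) (min y B)) (fun _ => (isSuperposition_clip hS hB).mono hS hM)
  have h6 := h5.linear (Ψ := fun u (i : Fin d) => u (some i))
    ⟨fun u v => rfl, fun c u => rfl⟩
  have hsize : (d + 1) * 2 + (5 * d + 6) * M + (d + 1) * n * s =
      (d + 1) * 2 + Fintype.card (Fin d ⊕ Bool) * M + Fintype.card ((Fin d × Bool) ⊕ Bool) * M +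
        Fintype.card (Option (Fin d) × Fin n) * s + Fintype.card (Option (Fin d)) * M +
        Fintype.card (Option (Fin d)) * M := by
    simp only [Fintype.card_sum, Fintype.card_prod, Fintype.card_option, Fintype.card_fin,
      Fintype.card_bool]
    ring
  rw [hsize]
  exact h6

theorem abs_clip_sub_le {B y g : ℝ} (hg : |g| ≤ B) : |max (-B) (min y B) - g| ≤ |y - g| := by
  obtain ⟨h1, h2⟩ := abs_le.1 hg
  rcases le_total y B with h | h
  · rw [min_eq_left h]
    rcases le_total (-B) y with h' | h'
    · rw [max_eq_right h']
    · rw [max_eq_left h', abs_of_nonpos (by linarith), abs_of_nonpos (by linarith)]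
      linarith
  · rw [min_eq_right h, max_eq_right (by linarith), abs_of_nonneg (by linarith),
      abs_of_nonneg (by linarith)]
    linarith

theorem abs_clip_le {B y : ℝ} (hB : 0 ≤ B) : |max (-B) (min y B)| ≤ B :=
  abs_le.2 ⟨le_max_left _ _, max_le (by linarith) (min_le_right _ _)⟩

theorem norm_approxArg_sub_le {gE gS gQ : ℝ → ℝ} {κ R ρ t : ℝ} (hκ0 : 0 ≤ κ) (hκ1 : κ ≤ 1)
    (ht : t ∈ Set.Icc (0 : ℝ) 1)
    (hE : |gE t - Real.exp (-t)| ≤ κ) (hSq : |gS t - √(1 - Real.exp (-2 * t))| ≤ κ)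
    (hQ : ∀ y, |y| ≤ R + 2 → |gQ y - y ^ 2| ≤ κ) {b z x : 𝔼} (hb : ‖b‖ ≤ 1) (hz : ‖z‖ ≤ ρ)
    (hx : ‖x‖ ≤ R) :
    ‖WithLp.toLp 2 (approxArg gE gS gQ b z x.ofLp t) -
      (Real.exp (-t) • (x + b) + √(1 - Real.exp (-2 * t)) • z)‖ ≤
      κ * (d * (1 + R) + 1 + ρ) := by
  have he0 := Real.exp_pos (-t)
  have he1 : Real.exp (-t) ≤ 1 := Real.exp_le_one_iff.2 (by linarith [ht.1])
  set e := Real.exp (-t)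
  set s := √(1 - Real.exp (-2 * t))
  -- `P` is the error of the product `e^{-t} x_k`. The squares contribute at most `κ/2` per
  -- coordinate and the error of `gE` at most `κ R`.
  set P : 𝔼 := WithLp.toLp 2 fun k => (gQ (x k + gE t) - gQ (x k - gE t)) / 4 - e * x k with hP
  have hdec : WithLp.toLp 2 (approxArg gE gS gQ b z x.ofLp t) - (e • (x + b) + s • z) =
      P + (gE t - e) • b + (gS t - s) • z := by
    ext k
    simp [approxArg, hP]
    ring
  have hEabs : |gE t| ≤ 2 := by
    obtain ⟨h1, h2⟩ := abs_le.1 hE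
    exact abs_le.2 ⟨by linarith, by linarith⟩
  have hPk : ∀ k, |P k| ≤ κ * (1 + R) := by
    intro k
    have hxk : |x k| ≤ R := (PiLp.norm_apply_le x k).trans hx
    have h1 := hQ (x k + gE t) ((abs_add_le _ _).trans (add_le_add hxk hEabs))
    have h2 := hQ (x k - gE t) ((abs_sub _ _).trans (add_le_add hxk hEabs))
    have h3 : |(gE t - e) * x k| ≤ κ * R := by
      rw [abs_mul]
      exact mul_le_mul hE hxk (abs_nonneg _) hκ0
    have h4 : P k = ((gQ (x k + gE t) - (x k + gE t) ^ 2) - (gQ (x k - gE t) - (x k - gE t) ^ 2)) / 4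
        + (gE t - e) * x k := by
      simp only [hP]; ring
    rw [h4]
    rw [abs_le] at *
    constructor <;> linarith [h1.1, h1.2, h2.1, h2.2, h3.1, h3.2]
  have hPn : ‖P‖ ≤ d * (κ * (1 + R)) := by
    refine (EuclideanSpace.norm_le_sum_abs P).trans ?_
    calc _ ≤ ∑ _k : Fin d, κ * (1 + R) := Finset.sum_le_sum fun k _ => hPk k
      _ = _ := by simp
  have hbn : ‖(gE t - e) • b‖ ≤ κ * 1 := by
    rw [norm_smul]
    exact mul_le_mul hE hb (norm_nonneg _) hκ0
  have hzn : ‖(gS t - s) • z‖ ≤ κ * ρ := by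
    rw [norm_smul]
    exact mul_le_mul hSq hz (norm_nonneg _) hκ0
  rw [hdec]
  calc _ ≤ d * (κ * (1 + R)) + κ * 1 + κ * ρ := (norm_add_le _ _).trans
        (add_le_add ((norm_add_le _ _).trans (add_le_add hPn hbn)) hzn)
    _ = _ := by ring

theorem abs_approxAvg_sub_ouSemigroup_le {L : ℝ≥0} {f : 𝔼 → ℝ} (hf : LipschitzWith L f)
    {gE gS gQ : ℝ → ℝ} {κ τ R ρ t ε δ : ℝ} (hκ0 : 0 ≤ κ) (hκ1 : κ ≤ 1)
    (hκτ : κ * (d * (1 + R) + 1 + ρ) ≤ τ) (hτ1 : τ ≤ 1) (ht : t ∈ Set.Icc (0 : ℝ) 1)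
    (hE : |gE t - Real.exp (-t)| ≤ κ) (hSq : |gS t - √(1 - Real.exp (-2 * t))| ≤ κ)
    (hQ : ∀ y, |y| ≤ R + 2 → |gQ y - y ^ 2| ≤ κ) {F : (Fin d → ℝ) → Fin 1 → ℝ}
    (hF : ∀ x : 𝔼, ‖x‖ ≤ R + 2 + ρ → |f x - F x.ofLp 0| ≤ ε) (hn : 0 < n) {z : Fin n → 𝔼}
    (hz : ∀ j, ‖z j‖ ≤ ρ)
    (hMC : ∀ a, ‖a‖ ≤ R + 1 → ∀ s : ℝ, |s| ≤ 1 →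
      |(∑ j, f (a + s • z j)) / n - ∫ z, f (a + s • z) ∂(stdGaussian 𝔼)| ≤ δ)
    {b x : 𝔼} (hb : ‖b‖ ≤ 1) (hx : ‖x‖ ≤ R) :
    |approxAvg gE gS gQ F z b x.ofLp t - ouSemigroup t f (x + b)| ≤ ε + L * τ + δ := by
  have hnR : (0 : ℝ) < n := by exact_mod_cast hn
  have he0 := Real.exp_pos (-t)
  have he1 : Real.exp (-t) ≤ 1 := Real.exp_le_one_iff.2 (by linarith [ht.1])
  have hs1 := abs_sqrt_one_sub_exp_le_one t
  have ha : ‖Real.exp (-t) • (x + b)‖ ≤ R + 1 := by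
    rw [norm_smul, Real.norm_eq_abs, abs_of_pos he0]
    exact (mul_le_of_le_one_left (norm_nonneg _) he1).trans
      ((norm_add_le _ _).trans (add_le_add hx hb))
  have h1 := hMC _ ha _ hs1
  set a := Real.exp (-t) • (x + b) with hadef
  set s := √(1 - Real.exp (-2 * t)) with hsdef
  have h2 : ∀ j, |F (approxArg gE gS gQ b (z j) x.ofLp t) 0 - f (a + s • z j)| ≤ ε + L * τ := by
    intro j
    have hw := (norm_approxArg_sub_le hκ0 hκ1 ht hE hSq hQ hb (hz j) hx).trans hκτ
    rw [← hadef, ← hsdef] at hw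
    set w : 𝔼 := WithLp.toLp 2 (approxArg gE gS gQ b (z j) x.ofLp t)
    have hsz : ‖s • z j‖ ≤ ρ := by
      rw [norm_smul]
      exact (mul_le_of_le_one_left (norm_nonneg _) hs1).trans (hz j)
    -- The exact argument has norm at most `R + 1 + ρ`, and the approximate one is within `τ ≤ 1` of
    -- it.
    have hwn : ‖w‖ ≤ R + 2 + ρ := by
      have h3 := norm_add_le (w - (a + s • z j)) (a + s • z j)
      rw [sub_add_cancel] at h3
      have h4 := norm_add_le a (s • z j)
      linarith
    have h5 := hF w hwn
    rw [abs_sub_comm] at h5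
    have h6 := (hf.abs_sub_le w (a + s • z j)).trans
      (mul_le_mul_of_nonneg_left hw L.coe_nonneg)
    exact (abs_sub_le _ (f w) _).trans (add_le_add h5 h6)
  have h3 : |approxAvg gE gS gQ F z b x.ofLp t - (∑ j, f (a + s • z j)) / n| ≤ ε + L * τ := by
    rw [approxAvg, ← sub_div, ← Finset.sum_sub_distrib, abs_div, abs_of_pos hnR,
      div_le_iff₀ hnR]
    calc _ ≤ ∑ _j : Fin n, (ε + L * τ) :=
          (Finset.abs_sum_le_sum_abs _ _).trans (Finset.sum_le_sum fun j _ => h2 j)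
      _ = _ := by simp; ring
  exact (abs_sub_le _ _ _).trans (add_le_add h3 h1)

/-! ### Closure properties of polynomial functions. -/

/-- Real functions of six variables given by a polynomial. -/
def IsPolynomialFun (g : (Fin 6 → ℝ) → ℝ) : Prop :=
  ∃ q : MvPolynomial (Fin 6) ℝ, ∀ v, q.eval v = g v

theorem IsPolynomialFun.coord (i : Fin 6) : IsPolynomialFun fun v => v i :=
  ⟨.X i, fun v => by simp⟩

theorem IsPolynomialFun.const (r : ℝ) : IsPolynomialFun fun _ => r :=
  ⟨.C r, fun v => by simp⟩

theorem IsPolynomialFun.add {g g' : (Fin 6 → ℝ) → ℝ} (h : IsPolynomialFun g)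
    (h' : IsPolynomialFun g') : IsPolynomialFun fun v => g v + g' v := by
  obtain ⟨q, hq⟩ := h
  obtain ⟨q', hq'⟩ := h'
  exact ⟨q + q', fun v => by simp [hq, hq']⟩

theorem IsPolynomialFun.mul {g g' : (Fin 6 → ℝ) → ℝ} (h : IsPolynomialFun g)
    (h' : IsPolynomialFun g') : IsPolynomialFun fun v => g v * g' v := by
  obtain ⟨q, hq⟩ := h
  obtain ⟨q', hq'⟩ := h'
  exact ⟨q * q', fun v => by simp [hq, hq']⟩

theorem IsPolynomialFun.pow {g : (Fin 6 → ℝ) → ℝ} (h : IsPolynomialFun g) (k : ℕ) :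
    IsPolynomialFun fun v => g v ^ k := by
  obtain ⟨q, hq⟩ := h
  exact ⟨q ^ k, fun v => by simp [hq]⟩

theorem IsPolynomialFun.eval (p : MvPolynomial (Fin 4) ℝ) {a b c e : (Fin 6 → ℝ) → ℝ}
    (ha : IsPolynomialFun a) (hb : IsPolynomialFun b) (hc : IsPolynomialFun c)
    (he : IsPolynomialFun e) : IsPolynomialFun fun v => p.eval ![a v, b v, c v, e v] := by
  obtain ⟨qa, ha⟩ := ha
  obtain ⟨qb, hb⟩ := hb
  obtain ⟨qc, hc⟩ := hc
  obtain ⟨qe, he⟩ := he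
  refine ⟨MvPolynomial.bind₁ ![qa, qb, qc, qe] p, fun v => ?_⟩
  rw [MvPolynomial.eval, MvPolynomial.eval₂Hom_bind₁]
  congr 2
  funext i
  fin_cases i
  · exact ha v
  · exact hb v
  · exact hc v
  · exact he v

end Score

/-! ### Choice of parameters and conclusion. -/

section Main

variable {d n : ℕ}

local notation "𝔼" => EuclideanSpace ℝ (Fin d)

/-- Each coordinate has error at most `ε / (d + 1)`, shared equally by the bias of the difference
quotient and the errors of the two logarithms. Using `d + 1` instead of `d` covers `d = 0`. -/
theorem norm_approxScore_sub_gradient_le {L : ℝ≥0} {f : 𝔼 → ℝ} (hd : Differentiable ℝ f)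
    (hf : LipschitzWith L f) (hg : LipschitzWith L (gradient f)) {c : ℝ} (hc0 : 0 < c)
    (hc : ∀ x, c ≤ f x) {gE gS gQ gL : ℝ → ℝ} {F : (Fin d → ℝ) → Fin 1 → ℝ} {z : Fin n → 𝔼}
    {h B B' η ε t : ℝ} (ht : 0 ≤ t) (hh0 : 0 < h) (hh1 : h ≤ 1) (hB : L / c ≤ B) {x : 𝔼}
    (havg : ∀ b : 𝔼, ‖b‖ ≤ 1 →
      |approxAvg gE gS gQ F z b x.ofLp t - ouSemigroup t f (x + b)| ≤ c * η / 2)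
    (hU : ∀ b : 𝔼, ‖b‖ ≤ 1 → ouSemigroup t f (x + b) ≤ B')
    (hlog : ∀ y u, u ∈ Set.Icc c B' → |gL y - Real.log u| ≤ η / 2 + |y - u| / c)
    (hbias : (L / c + L ^ 2 / c ^ 2) * h ≤ ε / (2 * (d + 1)))
    (hη : 2 * η / h ≤ ε / (2 * (d + 1))) (hε : 0 ≤ ε) :
    ‖WithLp.toLp 2 (approxScore gE gS gQ gL F z h B (withTime x t)) -
      gradient (fun y => Real.log (ouSemigroup t f y)) x‖ ≤ ε := by
  have hlogU : ∀ b : 𝔼, ‖b‖ ≤ 1 → |gL (approxAvg gE gS gQ F z b x.ofLp t) -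
      Real.log (ouSemigroup t f (x + b))| ≤ η := by
    intro b hb
    have h1 := hlog (approxAvg gE gS gQ F z b x.ofLp t) _
      ⟨le_ouSemigroup hf hc t (x + b), hU b hb⟩
    have h2 : |approxAvg gE gS gQ F z b x.ofLp t - ouSemigroup t f (x + b)| / c ≤ η / 2 := by
      rw [div_le_iff₀ hc0]
      linarith [havg b hb]
    linarith
  have hcoord : ∀ i, |(WithLp.toLp 2 (approxScore gE gS gQ gL F z h B (withTime x t)) -
      gradient (fun y => Real.log (ouSemigroup t f y)) x : 𝔼) i| ≤ ε / (d + 1) := by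
    intro i
    have hb : ‖h • (EuclideanSpace.single i 1 : 𝔼)‖ ≤ 1 := by
      rw [norm_smul, PiLp.norm_single, norm_one, mul_one, Real.norm_eq_abs, abs_of_pos hh0]
      exact hh1
    have h1 := hlogU _ hb
    have h0 := hlogU 0 (by simp)
    rw [add_zero] at h0
    have h2 := abs_difference_quotient_sub_gradient_le hd hf hg hc0 hc ht x i hh0
    have h3 := abs_gradient_log_ouSemigroup_apply_le hd hf hg hc0 hc ht x i
    have hw : (fun k : Fin d => withTime x t k.castSucc) = x.ofLp := by
      funext k; simp [withTime]
    have hw' : withTime x t (Fin.last d) = t := by simp [withTime]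
    rw [PiLp.sub_apply]
    simp only [approxScore, hw, hw']
    refine (abs_clip_sub_le (h3.trans hB)).trans ?_
    set a₁ := gL (approxAvg gE gS gQ F z (h • EuclideanSpace.single i 1) x.ofLp t)
    set a₀ := gL (approxAvg gE gS gQ F z 0 x.ofLp t)
    set l₁ := Real.log (ouSemigroup t f (x + h • EuclideanSpace.single i 1))
    set l₀ := Real.log (ouSemigroup t f x)
    have h4 : |(a₁ - a₀) / h - (l₁ - l₀) / h| ≤ 2 * η / h := by
      rw [← sub_div, abs_div, abs_of_pos hh0]
      gcongr
      rw [abs_le] at *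
      constructor <;> linarith [h1.1, h1.2, h0.1, h0.2]
    have h5 := abs_sub_le ((a₁ - a₀) / h) ((l₁ - l₀) / h)
      (gradient (fun y => Real.log (ouSemigroup t f y)) x i)
    have h6 : ε / (d + 1) = ε / (2 * (d + 1)) + ε / (2 * (d + 1)) := by
      field_simp; norm_num
    linarith
  refine (EuclideanSpace.norm_le_sum_abs _).trans ?_
  calc _ ≤ ∑ _i : Fin d, ε / (d + 1) := Finset.sum_le_sum fun i _ => hcoord i
    _ = d * (ε / (d + 1)) := by simp
    _ ≤ (d + 1) * (ε / (d + 1)) := by gcongr; linarith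
    _ = ε := by field_simp

/-- The approximation of the score by a net, with a size bound in terms of auxiliary parameters. -/
theorem exists_net_score {σ : ℝ → ℝ} {p : MvPolynomial (Fin 4) ℝ} {C : ℝ} (hC : 0 < C)
    {S : Set (ℝ → ℝ)} (hS : relu ∈ S) (hσS : σ ∈ S) (hA : ApproximatesLipschitz S C)
    {L : ℝ≥0} {f : 𝔼 → ℝ} (hd : Differentiable ℝ f) (hf : LipschitzWith L f)
    (hg : LipschitzWith L (gradient f)) (hL0 : 0 < L) {c : ℝ} (hc0 : 0 < c) (hc1 : c ≤ 1)
    (hc : ∀ x, c ≤ f x) (hint : ∫ z, f z ∂(stdGaussian 𝔼) = 1) (hnet : NetApproximable σ p L f)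
    {ε R : ℝ} (hε : 0 < ε) (hR : 0 < R) {H N D T ρ K Mb Nb : ℝ}
    (hH : H = 2 * (d + 1) * (1 / ε) * (L * (1 / c) + (L * (1 / c)) ^ 2) + 1)
    (hN : N = 4 * (d + 1) * H * (1 / ε)) (hD : D = 2 * N * (1 / c)) (hT : T = 4 * D * L + 1)
    (hρ : ρ = 8 * L * d * D + 1) (hK : K = T * (d * (1 + R) + 1 + ρ))
    (hMb : Mb = C * (K + 4 * K ^ 2 + 2 * (R + 2) ^ 2 * K +
      (1 + L * (R + 2 * d + 3)) * (1 / c) * (2 * N)) + 4)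
    (hNb : Nb = (1 + (8 * L * (2 * d * (R + 1) + 2 * ρ) * (2 * D) + 2) * (d + 1)) *
      (32 * L ^ 2 * ρ ^ 2 * (2 * D) ^ 2) + 2) :
    ∃ (ℓ s : ℕ) (v : (Fin (d + 1) → ℝ) → (Fin d → ℝ)),
      IsNeuralNet S (d + 1) ℓ s d v ∧
      (s : ℝ) ≤ (d + 1) * 2 + (5 * d + 6) * Mb +
        (d + 1) * Nb * p.eval ![4 * D, (d : ℝ), (L : ℝ), R + 2 + ρ] ∧
      (∀ x ∈ Metric.closedBall (0 : 𝔼) R, ∀ t ∈ Set.Icc (0 : ℝ) 1,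
        DifferentiableAt ℝ (fun y => Real.log (ouSemigroup t f y)) x ∧
        ‖WithLp.toLp 2 (v (withTime x t)) -
          gradient (fun y => Real.log (ouSemigroup t f y)) x‖ ≤ ε) ∧
      (∀ (x : 𝔼), ∀ t ∈ Set.Icc (0 : ℝ) 1, ∀ i : Fin d, |v (withTime x t) i| ≤ 2 * L / c) := by
  -- The parameters are inverse accuracies: `1/H` is the step `h`, `1/N` the error of the
  -- logarithms, `1/D = c / (2N)` that of the averages, `1/T` that of the arguments and `1/K` that
  -- of `gE`, `gS` and `gQ`. The sample lies in the ball of radius `ρ`; `Mb` and `Nb` bound the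
  -- neurons per superposition and the sample size.
  have hL : (0 : ℝ) < L := hL0
  have hH1 : 1 ≤ H := by
    have : 0 ≤ 2 * (d + 1) * (1 / ε) * (L * (1 / c) + (L * (1 / c)) ^ 2) := by positivity
    linarith
  have hH0 : 0 < H := by linarith
  have hN0 : 0 < N := by rw [hN]; positivity
  have hD0 : 0 < D := by rw [hD]; positivity
  have hT1 : 1 ≤ T := by
    have : 0 ≤ 4 * D * L := by positivity
    linarith
  have hT0 : 0 < T := by linarith
  have hρ1 : 1 ≤ ρ := by
    have : 0 ≤ 8 * L * d * D := by positivity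
    linarith
  have hρ0 : 0 < ρ := by linarith
  have hG1 : 1 ≤ d * (1 + R) + 1 + ρ := by
    have : 0 ≤ d * (1 + R) := by positivity
    linarith
  have hG0 : 0 < d * (1 + R) + 1 + ρ := by linarith
  have hK1 : 1 ≤ K := by rw [hK]; exact one_le_mul_of_one_le_of_one_le hT1 hG1
  have hK0 : 0 < K := by linarith
  set B' : ℝ := 1 + L * (R + 2 * d + 3) with hB'
  have hB'1 : 1 ≤ B' := by
    have : 0 ≤ L * (R + 2 * d + 3) := by positivity
    linarith
  have hB'0 : 0 < B' := by linarith
  have hMb4 : 4 ≤ Mb := by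
    have : 0 ≤ C * (K + 4 * K ^ 2 + 2 * (R + 2) ^ 2 * K + B' * (1 / c) * (2 * N)) := by positivity
    linarith
  -- `Mb` adds the costs of all four superpositions, so one `M` serves each; its summand `4` absorbs
  -- the floor, the constant neuron and the clipping.
  set M : ℕ := ⌊Mb⌋₊ with hM
  have hM3 : 3 ≤ M := Nat.le_floor (by push_cast; linarith)
  have hMle : (M : ℝ) ≤ Mb := Nat.floor_le (by linarith)
  have hMge : Mb - 1 ≤ M := by linarith [Nat.lt_floor_add_one Mb]
  have hMof : ∀ a, a ≤ K + 4 * K ^ 2 + 2 * (R + 2) ^ 2 * K + B' * (1 / c) * (2 * N) →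
      C * a + 1 ≤ M := by
    intro a ha
    have := mul_le_mul_of_nonneg_left ha hC.le
    linarith
  have hn1 : 0 ≤ K := hK0.le
  have hn2 : 0 ≤ 4 * K ^ 2 := by positivity
  have hn3 : 0 ≤ 2 * (R + 2) ^ 2 * K := by positivity
  have hn4 : 0 ≤ B' * (1 / c) * (2 * N) := by positivity
  obtain ⟨gE, hgE, hE⟩ := hA.exp_neg (δ := 1 / K) (by positivity) (M := M)
    (hMof _ (by rw [one_div_one_div]; linarith))
  obtain ⟨gS, hgS, hSq⟩ := hA.sqrt_one_sub_exp (δ := 1 / K) (by positivity) (M := M)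
    (hMof _ (by
      rw [show 4 / (1 / K) ^ 2 = 4 * K ^ 2 by field_simp]; linarith))
  obtain ⟨gQ, hgQ, hQ⟩ := hA.sq (B := R + 2) (δ := 1 / K) (by positivity) (by positivity) (M := M)
    (hMof _ (by
      rw [show 2 * (R + 2) ^ 2 / (1 / K) = 2 * (R + 2) ^ 2 * K by field_simp]; linarith))
  obtain ⟨gL, hgL, hlog⟩ := hA.log (B := B') (c := c) (δ := 1 / N / 2) hc0 (hc1.trans hB'1)
    (by positivity) (M := M) (hMof _ (by
      rw [show B' / c / (1 / N / 2) = B' * (1 / c) * (2 * N) by field_simp]; linarith))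
  obtain ⟨n, hn, hnle, z, hz, hMC⟩ := hf.exists_uniform_sample hL0 (A := R + 1) (δ := 1 / (2 * D))
    (ρ := ρ) (by positivity) (by positivity) (by
      rw [hρ, show 4 * L * d / (1 / (2 * D)) = 8 * L * d * D by field_simp; ring])
  have hnle' : (n : ℝ) ≤ Nb := by
    refine hnle.trans (le_of_eq ?_)
    rw [hNb]
    field_simp
  obtain ⟨ℓ, s, F, hF, -, hs, hFf⟩ := hnet (R + 2 + ρ) (1 / (4 * D)) (by positivity)
    (by positivity)
  rw [one_div_one_div] at hs
  have hB : 0 ≤ 2 * (L : ℝ) / c := by positivity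
  obtain ⟨ℓ', hv⟩ := (netOutput_approxScore hS (Set.singleton_subset_iff.2 hσS) hM3 hgE hgS hgQ
    hgL hF hn z (1 / H) hB).isNeuralNet
  refine ⟨ℓ', _, _, hv, ?_, fun x hx t ht => ⟨?_, ?_⟩, fun x t _ i => abs_clip_le hB⟩
  · push_cast
    have hs0 : (0 : ℝ) ≤ s := Nat.cast_nonneg s
    have hNb0 : 0 ≤ Nb := (Nat.cast_nonneg n).trans hnle'
    gcongr
  · exact (hasFDerivAt_log_ouSemigroup hd hf hg hc0 hc ht.1 x).differentiableAt
  have hxR : ‖x‖ ≤ R := by simpa using hx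
  refine norm_approxScore_sub_gradient_le hd hf hg hc0 hc ht.1 (by positivity)
    ((div_le_one hH0).2 hH1) (by gcongr; linarith) (B' := B') (η := 1 / N) (fun b hb => ?_)
    (fun b hb => ?_) hlog ?_ ?_ hε.le
  · refine (abs_approxAvg_sub_ouSemigroup_le hf (κ := 1 / K) (τ := 1 / T) (by positivity)
      ((div_le_one hK0).2 hK1) (le_of_eq ?_) ((div_le_one hT0).2 hT1) ht (hE t ht) (hSq t ht) hQ
      (fun y hy => (hFf y (by simpa using hy)).1) hn hz hMC hb hxR).trans ?_
    · rw [hK]; field_simp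
    -- The accuracy `1/D` is split into `1/(4D)` for the net for `f`, `1/(4D)` for the arguments and
    -- `1/(2D)` for the sample.
    · have h1 : (L : ℝ) * (1 / T) ≤ 1 / (4 * D) := by
        rw [mul_one_div, div_le_div_iff₀ hT0 (by positivity), hT]
        linarith
      have h2 : c * (1 / N) / 2 = 1 / (4 * D) + 1 / (4 * D) + 1 / (2 * D) := by
        rw [hD]; field_simp; norm_num
      linarith
  · refine (ouSemigroup_le hf hint ht.1 (x + b)).trans ?_
    rw [hB']
    have : ‖x + b‖ ≤ R + 1 := (norm_add_le _ _).trans (add_le_add hxR hb)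
    have := mul_le_mul_of_nonneg_left this hL.le
    linarith
  · rw [mul_one_div, div_le_div_iff₀ hH0 (by positivity)]
    have h1 : ε * H = 2 * (d + 1) * (L / c + L ^ 2 / c ^ 2) + ε := by
      rw [hH]; field_simp
    linarith
  · refine le_of_eq ?_
    rw [hN]
    field_simp
    norm_num

end Main

/-- A polynomial bound for the size of the net in terms of `(1/ε, d, L, R, c, 1/c)`. -/
theorem exists_polynomial_size_bound (C : ℝ) (p : MvPolynomial (Fin 4) ℝ) :
    ∃ H N D T ρ K Mb Nb : (Fin 6 → ℝ) → ℝ,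
      (∀ v, H v = 2 * (v 1 + 1) * v 0 * (v 2 * v 5 + (v 2 * v 5) ^ 2) + 1) ∧
      (∀ v, N v = 4 * (v 1 + 1) * H v * v 0) ∧ (∀ v, D v = 2 * N v * v 5) ∧
      (∀ v, T v = 4 * D v * v 2 + 1) ∧ (∀ v, ρ v = 8 * v 2 * v 1 * D v + 1) ∧
      (∀ v, K v = T v * (v 1 * (1 + v 3) + 1 + ρ v)) ∧
      (∀ v, Mb v = C * (K v + 4 * K v ^ 2 + 2 * (v 3 + 2) ^ 2 * K v +
        (1 + v 2 * (v 3 + 2 * v 1 + 3)) * v 5 * (2 * N v)) + 4) ∧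
      (∀ v, Nb v = (1 + (8 * v 2 * (2 * v 1 * (v 3 + 1) + 2 * ρ v) * (2 * D v) + 2) *
        (v 1 + 1)) * (32 * v 2 ^ 2 * ρ v ^ 2 * (2 * D v) ^ 2) + 2) ∧
      ∃ q : MvPolynomial (Fin 6) ℝ, ∀ v, q.eval v = (v 1 + 1) * 2 + (5 * v 1 + 6) * Mb v +
        (v 1 + 1) * Nb v * p.eval ![4 * D v, v 1, v 2, v 3 + 2 + ρ v] := by
  -- The witnesses are read off from the equations by unification; the size is then built from
  -- coordinates and constants by operations that preserve polynomials.
  refine ⟨_, _, _, _, _, _, _, _, fun v => rfl, fun v => rfl, fun v => rfl, fun v => rfl,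
    fun v => rfl, fun v => rfl, fun v => rfl, fun v => rfl, ?_⟩
  change IsPolynomialFun _
  repeat' first
    | exact .coord _
    | exact .const _
    | refine .eval _ ?_ ?_ ?_ ?_
    | refine .pow ?_ _
    | refine .mul ?_ ?_
    | refine .add ?_ ?_

theorem mainTheorem3 (σ : ℝ → ℝ) (hσ : ActivationAssumption σ) (p : MvPolynomial (Fin 4) ℝ) :
    ∃ q : MvPolynomial (Fin 6) ℝ,
      ∀ (d : ℕ) (π : Measure (EuclideanSpace ℝ (Fin d)))
        (f : EuclideanSpace ℝ (Fin d) → ℝ) (L : ℝ≥0) (c : ℝ),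
        IsProbabilityMeasure π →
        π = (stdGaussian (EuclideanSpace ℝ (Fin d))).withDensity
          (fun x => ENNReal.ofReal (f x)) →
        Differentiable ℝ f → LipschitzWith L f → LipschitzWith L (gradient f) →
        0 < c → c ≤ 1 → (∀ x, c ≤ f x) →
        NetApproximable σ p L f →
        ∀ ε R : ℝ, 0 < ε → ε < 4 * L / c → 0 < R →
          ∃ (ℓ s : ℕ) (v : (Fin (d + 1) → ℝ) → (Fin d → ℝ)),
            IsNeuralNet {σ, deriv σ, relu} (d + 1) ℓ s d v ∧
            (s : ℝ) ≤ q.eval ![1 / ε, (d : ℝ), (L : ℝ), R, c, 1 / c] ∧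
            (∀ x ∈ Metric.closedBall (0 : EuclideanSpace ℝ (Fin d)) R, ∀ t ∈ Set.Icc (0 : ℝ) 1,
              DifferentiableAt ℝ (fun y => Real.log (ouSemigroup t f y)) x ∧
              ‖WithLp.toLp 2 (v (withTime x t)) -
                gradient (fun y => Real.log (ouSemigroup t f y)) x‖ ≤ ε) ∧
            (∀ (x : EuclideanSpace ℝ (Fin d)), ∀ t ∈ Set.Icc (0 : ℝ) 1, ∀ i : Fin d,
              |v (withTime x t) i| ≤ 2 * L / c) := by
  obtain ⟨C, hC, hA⟩ := hσ.approximatesLipschitz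
  obtain ⟨H, N, D, T, ρ, K, Mb, Nb, hH, hN, hD, hT, hρ, hK, hMb, hNb, q, hq⟩ :=
    exists_polynomial_size_bound C p
  refine ⟨q, fun d π f L c hπ hπf hd hf hg hc0 hc1 hc hnet ε R hε hεL hR => ?_⟩
  subst hπf
  -- For `L = 0` there is no admissible `ε`, because `ε < 4L/c`.
  have hL0 : 0 < L := by
    by_contra! h
    have h0 : L = 0 := le_antisymm h bot_le
    simp only [h0, NNReal.coe_zero, mul_zero, zero_div] at hεL
    linarith
  rw [hq]
  exact exists_net_score hC (by simp) (by simp) (hA _ (by simp) (by simp)) hd hf hg hL0 hc0 hc1 hc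
    (integral_eq_one_of_withDensity hf.continuous (fun x => hc0.le.trans (hc x)) hπ) hnet hε hR
    (hH _) (hN _) (hD _) (hT _) (hρ _) (hK _) (hMb _) (hNb _)
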